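/- For a matroid $M$ on a finite set $E$, let $L_M\subset\mathbb{R}^{E}/\mathbb{R}(1,\dots,1)$ be its tropical linear space (Bergman fan), i.e. the set of classes of vectors $v$ such that on every circuit of $M$ the maximum of the coordinates of $v$ is attained at least twice. Let $U_{r,m}$ be the uniform matroid of rank $r$ on $m$ elements. Fix $n\ge 0$ and put $X=L_{U_{n+1,n+1}}$ and $D=L_{U_{n,n+1}}\subset X$ (for $n=0$, $D=\varnothing$). Then $X=\mathbb{R}^{n+1}/\mathbb{R}(1,\dots,1)\cong\mathbb{R}^n$ (an integral affine isomorphism). Let $j\colon X\setminus D\to X$ be the inclusion, let $(X\setminus D)^\dagger=\bigsqcup_{U\in\pi_0(X\setminus D)}\overline{U}$ be the disjoint union of the closures in $X$ of the connected components of $X\setminus D$, let $\iota\colon (X\setminus D)^\dagger\to X$ be the map induced by the inclusions $\overline U\subset X$, and let $i\colon X\setminus D\to (X\setminus D)^\dagger$ be the inclusion sending a point to itself in the closure of its component. Then: 1. $i$ is an open embedding and is locally aspheric: every point of $(X\setminus D)^\dagger$ has arbitrarily small contractible open neighbourhoods $V$ such that $i^{-1}(V)$ is contractible; 2. $\iota\circ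 i=j$; 3. $Rj_*\mathbb{R}_{X\setminus D}=\iota_!\mathbb{R}_{(X\setminus D)^\dagger}$; more precisely, the canonical morphism $$\iota_!\mathbb{R}_{(X\setminus D)^\dagger}\to \iota_*\mathbb{R}_{(X\setminus D)^\dagger}\to\iota_*i_*\mathbb{R}_{X\setminus D}=j_*\mathbb{R}_{X\setminus D}\to Rj_*\mathbb{R}_{X\setminus D}$$ is an isomorphism in the bounded below derived category of sheaves of real vector spaces on $X$, where $\iota_!$ is the direct image with proper supports and $\mathbb{R}_Y$ denotes the constant sheaf on $Y$. -/

import Mathlib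

open CategoryTheory TopologicalSpace Opposite Filter Topology

namespace TropicalComplement

/-- The uniform matroid `U_{r,m}` of rank `r` on `m` elements (for `r ≤ m`): a set is independent
if and only if it has at most `r` elements. -/
noncomputable def uniformMatroid (r m : ℕ) : Matroid (Fin m) :=
  (IndepMatroid.ofFinite (E := Set.univ) Set.finite_univ (fun I => I.ncard ≤ r)
    (by simp)
    (fun I J hJ hIJ => (Set.ncard_le_ncard hIJ (Set.toFinite J)).trans hJ)
    (fun I J _ hJ hIJ => by
      obtain ⟨e, heJ, heI⟩ := Set.exists_mem_notMem_of_ncard_lt_ncard hIJ (Set.toFinite I)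
      refine ⟨e, heJ, heI, ?_⟩
      have := Set.ncard_insert_of_notMem heI (Set.toFinite I)
      omega)
    (fun I _ => Set.subset_univ I)).matroid

/-- The space `ℝ^E / ℝ·(1,…,1)`, with its quotient topology. -/
abbrev TropicalTorus (E : Type) : Type := (E → ℝ) ⧸ Submodule.span ℝ {(1 : E → ℝ)}

/-- The support of the tropical linear space `L_M` (Bergman fan) of a matroid `M`, in the
max-convention: the classes of the `v` such that on every circuit the maximum of `v` is attained
at least twice. -/
def tropicalLinearSpace {E : Type} (M : Matroid E) : Set (TropicalTorus E) :=
  (Submodule.span ℝ {(1 : E → ℝ)}).mkQ '' {v | ∀ C : Set E, M.IsCircuit C →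
    ∃ i ∈ C, ∃ j ∈ C, i ≠ j ∧ (∀ k ∈ C, v k ≤ v i) ∧ (∀ k ∈ C, v k ≤ v j)}

/-- The space `X = L_{U_{n+1,n+1}}`. -/
abbrev X (n : ℕ) : Type := tropicalLinearSpace (uniformMatroid (n + 1) (n + 1))

/-- The subset `D = L_{U_{n,n+1}}` of `X`. -/
def D (n : ℕ) : Set (X n) := {x | x.1 ∈ tropicalLinearSpace (uniformMatroid n (n + 1))}

/-- The disjoint union of the closures, in `Z`, of the connected components of `W ⊆ Z`. -/
abbrev Dagger {Z : Type} [TopologicalSpace Z] (W : Set Z) : Type :=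
  Σ c : ConnectedComponents W,
    (closure (Subtype.val '' (ConnectedComponents.mk ⁻¹' {c} : Set W)) : Set Z)

/-- The canonical inclusion `W → Dagger W`. -/
def toDagger {Z : Type} [TopologicalSpace Z] (W : Set Z) (x : W) : Dagger W :=
  ⟨ConnectedComponents.mk x, x.1, subset_closure ⟨x, rfl, rfl⟩⟩

/-- The canonical map `ι : Dagger W ⟶ Z`. -/
def daggerMap {Z : Type} [TopologicalSpace Z] (W : Set Z) : TopCat.of (Dagger W) ⟶ TopCat.of Z :=
  TopCat.ofHom ⟨fun p => p.2.1, continuous_sigma fun _ => continuous_subtype_val⟩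

/-- The inclusion `j : W ⟶ Z` of a subspace. -/
def inclusionMap {Z : Type} [TopologicalSpace Z] (W : Set Z) : TopCat.of W ⟶ TopCat.of Z :=
  TopCat.ofHom ⟨Subtype.val, continuous_subtype_val⟩

/-- A map `f : Y → Z` is locally aspheric if every point of `Z` has arbitrarily small contractible
open neighbourhoods with contractible preimage in `Y`. -/
def LocallyAspheric {Y Z : Type} [TopologicalSpace Y] [TopologicalSpace Z] (f : Y → Z) : Prop :=
  ∀ z : Z, ∀ N ∈ 𝓝 z, ∃ V : Set Z, IsOpen V ∧ z ∈ V ∧ V ⊆ N ∧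
    ContractibleSpace V ∧ ContractibleSpace (f ⁻¹' V)

/-- Sheaves of real vector spaces on `Y`. -/
abbrev SheafR (Y : TopCat.{0}) := TopCat.Sheaf (ModuleCat.{0} ℝ) Y

/-- The standard model of the derived category of sheaves of real vector spaces. -/
noncomputable instance hasDerivedCategorySheafR (Y : TopCat.{0}) : HasDerivedCategory (SheafR Y) :=
  HasDerivedCategory.standard _

instance pushforward_additive {Y Z : TopCat.{0}} (f : Y ⟶ Z) :
    (TopCat.Sheaf.pushforward (ModuleCat.{0} ℝ) f).Additive where

/-- The restriction `S ∩ f ⁻¹(U) → U` of `f` to `S` is a proper map. -/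
def ProperOver {X Y : Type} [TopologicalSpace X] [TopologicalSpace Y] (f : Y → X)
    (S : Set Y) (U : Set X) : Prop :=
  IsProperMap (fun y : {y : Y // y ∈ S ∧ f y ∈ U} => (⟨f y.1, y.2.2⟩ : U))

theorem properOver_iff {X Y : Type} [TopologicalSpace X] [TopologicalSpace Y] {f : Y → X}
    (hf : Continuous f) (S : Set Y) {U : Set X} (hU : IsOpen U) :
    ProperOver f S U ↔ ∀ 𝒰 : Ultrafilter Y, S ∈ 𝒰 → ∀ x ∈ U, Tendsto f 𝒰 (𝓝 x) →
      ∃ y ∈ S, f y = x ∧ (𝒰 : Filter Y) ≤ 𝓝 y := by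
  unfold ProperOver
  rw [isProperMap_iff_ultrafilter]
  constructor
  · rintro ⟨-, h⟩ 𝒰 hS x hx hlim
    have hT : {y : Y | y ∈ S ∧ f y ∈ U} ∈ 𝒰 :=
      Filter.inter_mem hS (hlim (hU.mem_nhds hx))
    have hr : Set.range (Subtype.val : {y : Y // y ∈ S ∧ f y ∈ U} → Y) ∈ 𝒰 := by
      rw [Subtype.range_coe_subtype]; exact hT
    have hm : Filter.map Subtype.val (Ultrafilter.comap 𝒰 Subtype.val_injective hr :
        Filter {y : Y // y ∈ S ∧ f y ∈ U}) = 𝒰 := by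
      rw [Ultrafilter.coe_comap]; exact Filter.map_comap_of_mem hr
    obtain ⟨y, hy, hle⟩ := h (𝒰 := Ultrafilter.comap 𝒰 Subtype.val_injective hr)
      (y := ⟨x, hx⟩) (by
        rw [tendsto_subtype_rng]
        change Tendsto (f ∘ Subtype.val) _ _
        rw [← tendsto_map'_iff, hm]
        exact hlim)
    refine ⟨y.1, y.2.1, congrArg Subtype.val hy, ?_⟩
    rw [← hm]
    exact (Filter.map_mono hle).trans continuous_subtype_val.continuousAt
  · intro h
    refine ⟨Continuous.subtype_mk (hf.comp continuous_subtype_val) _, ?_⟩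
    intro 𝒱 x hlim
    obtain ⟨y, hyS, hyx, hle⟩ := h (𝒱.map Subtype.val)
      (Filter.mem_map.2 (Filter.univ_mem' fun y => y.2.1)) x.1 x.2 (by
        rw [tendsto_subtype_rng] at hlim
        rw [Ultrafilter.coe_map, tendsto_map'_iff]
        exact hlim)
    refine ⟨⟨y, hyS, hyx ▸ x.2⟩, Subtype.ext hyx, ?_⟩
    rw [nhds_subtype_eq_comap]
    exact Filter.map_le_iff_le_comap.1 (by simpa using hle)

/-- The support of a section `s ∈ F(W)`: the complement in `W` of the largest open subset of `W` on
which `s` vanishes. -/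
def sectionSupport {Y : TopCat.{0}} (F : SheafR Y) (W : Opens Y) (s : F.1.obj (op W)) : Set Y :=
  {y | y ∈ W ∧ ∀ (V : Opens Y) (h : V ≤ W), y ∈ V → F.1.map (homOfLE h).op s ≠ 0}

theorem ProperOver.of_subset {X Y : TopCat.{0}} {f : Y ⟶ X} {U : Opens X} (F : SheafR Y)
    (s t u : F.1.obj (op ((Opens.map f).obj U)))
    (hs : ProperOver f (sectionSupport F _ s) U) (ht : ProperOver f (sectionSupport F _ t) U)
    (h : sectionSupport F _ u ⊆ sectionSupport F _ s ∪ sectionSupport F _ t) :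
    ProperOver f (sectionSupport F _ u) U := by
  rw [properOver_iff f.hom.continuous _ U.isOpen] at *
  intro 𝒰 hu x hx hlim
  have key : ∃ y, f y = x ∧ (𝒰 : Filter Y) ≤ 𝓝 y := by
    rcases (Ultrafilter.union_mem_iff).1 (Filter.mem_of_superset hu h) with h1 | h1
    · obtain ⟨y, -, h2⟩ := hs 𝒰 h1 x hx hlim
      exact ⟨y, h2⟩
    · obtain ⟨y, -, h2⟩ := ht 𝒰 h1 x hx hlim
      exact ⟨y, h2⟩
  obtain ⟨y, hyx, hle⟩ := key
  refine ⟨y, ⟨?_, ?_⟩, hyx, hle⟩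
  · change f y ∈ U
    rw [hyx]; exact hx
  · intro V hV hyV h0
    obtain ⟨z, hz, hzV⟩ := 𝒰.nonempty_of_mem
      (Filter.inter_mem hu (hle (V.isOpen.mem_nhds hyV)))
    exact hz.2 V hV hzV h0

theorem sectionSupport_map {Y : TopCat.{0}} (F : SheafR Y) {W W' : Opens Y} (h : W' ⟶ W)
    (s : F.1.obj (op W)) :
    sectionSupport F W' (F.1.map h.op s) = sectionSupport F W s ∩ W' := by
  have hmap : ∀ (V : Opens Y) (h' : V ≤ W'), F.1.map (homOfLE h').op (F.1.map h.op s) =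
      F.1.map (homOfLE (h'.trans h.le)).op s := by
    intro V h'
    rw [← ConcreteCategory.comp_apply, ← F.1.map_comp]
    rfl
  ext y
  constructor
  · rintro ⟨hy, hV⟩
    refine ⟨⟨h.le hy, fun V hVW hyV h0 => ?_⟩, hy⟩
    refine hV (V ⊓ W') inf_le_right ⟨hyV, hy⟩ ?_
    rw [hmap]
    have : (homOfLE ((inf_le_right : V ⊓ W' ≤ W').trans h.le)).op =
        (homOfLE hVW).op ≫ (homOfLE (inf_le_left : V ⊓ W' ≤ V)).op := rfl
    rw [this, F.1.map_comp, ConcreteCategory.comp_apply, h0, map_zero]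
  · rintro ⟨⟨-, hV⟩, hy⟩
    refine ⟨hy, fun V hVW hyV h0 => ?_⟩
    rw [hmap] at h0
    exact hV V _ hyV h0

/-- The sections of `F` over `f ⁻¹(U)` whose support is proper over `U`. -/
def properSections {X Y : TopCat.{0}} (f : Y ⟶ X) (F : SheafR Y) (U : Opens X) :
    Submodule ℝ (F.1.obj (op ((Opens.map f).obj U))) where
  carrier := {s | ProperOver f (sectionSupport F _ s) U}
  add_mem' {s t} hs ht := by
    refine ProperOver.of_subset F s t _ hs ht fun y hy => ?_
    by_contra hcon
    simp only [Set.mem_union, not_or, sectionSupport, Set.mem_ofPred_eq, not_and, not_forall,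
      not_not] at hcon
    obtain ⟨V, hV, hyV, h1⟩ := hcon.1 hy.1
    obtain ⟨V', hV', hyV', h2⟩ := hcon.2 hy.1
    refine hy.2 (V ⊓ V') (inf_le_left.trans hV) ⟨hyV, hyV'⟩ ?_
    have e1 : (homOfLE (inf_le_left.trans hV : V ⊓ V' ≤ _)).op =
      (homOfLE hV).op ≫ (homOfLE (inf_le_left : V ⊓ V' ≤ V)).op := rfl
    have e2 : (homOfLE (inf_le_left.trans hV : V ⊓ V' ≤ _)).op =
      (homOfLE hV').op ≫ (homOfLE (inf_le_right : V ⊓ V' ≤ V')).op := rfl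
    rw [map_add]
    conv_lhs => arg 1; rw [e1, F.1.map_comp, ConcreteCategory.comp_apply, h1, map_zero]
    rw [e2, F.1.map_comp, ConcreteCategory.comp_apply, h2, map_zero, add_zero]
  zero_mem' := by
    have h0 : sectionSupport F ((Opens.map f).obj U) 0 = ∅ := by
      ext y
      simp only [Set.mem_empty_iff_false, iff_false]
      rintro ⟨hy, h⟩
      exact h _ le_rfl hy (map_zero _)
    change ProperOver f (sectionSupport F _ 0) U
    rw [h0, properOver_iff f.hom.continuous _ U.isOpen]
    intro 𝒰 h
    exact absurd h 𝒰.empty_notMem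
  smul_mem' c s hs := by
    refine ProperOver.of_subset F s s _ hs hs fun y hy => Or.inl ⟨hy.1, fun V hV hyV h0 => ?_⟩
    exact hy.2 V hV hyV (by rw [map_smul, h0, smul_zero])

theorem map_mem_properSections {X Y : TopCat.{0}} (f : Y ⟶ X) (F : SheafR Y) {U U' : Opens X} (h : U' ⟶ U)
    (s : F.1.obj (op ((Opens.map f).obj U))) (hs : s ∈ properSections f F U) :
    F.1.map ((Opens.map f).map h).op s ∈ properSections f F U' := by
  change ProperOver f _ U at hs
  change ProperOver f _ U'
  rw [properOver_iff f.hom.continuous _ (Opens.isOpen _)] at *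
  rw [sectionSupport_map]
  intro 𝒰 hu x hx hlim
  obtain ⟨y, hy, hyx, hle⟩ := hs 𝒰 (Filter.mem_of_superset hu Set.inter_subset_left) x
    (h.le hx) hlim
  refine ⟨y, ⟨hy, ?_⟩, hyx, hle⟩
  change f y ∈ U'
  rw [hyx]; exact hx

/-- The presheaf `U ↦ {s ∈ F(f ⁻¹(U)) | supp s → U is proper}`. -/
noncomputable def properPresheaf {X Y : TopCat.{0}} (f : Y ⟶ X) (F : SheafR Y) : TopCat.Presheaf (ModuleCat.{0} ℝ) X where
  obj U := ModuleCat.of ℝ (properSections f F U.unop)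
  map {U U'} h := ModuleCat.ofHom ((F.1.map ((Opens.map f).map h.unop).op).hom.restrict
    (fun s hs => map_mem_properSections f F h.unop s hs))
  map_id U := by
    ext s
    change F.1.map (𝟙 _) s.1 = s.1
    rw [F.1.map_id]; rfl
  map_comp {U U' U''} h h' := by
    ext s
    change F.1.map (((Opens.map f).map h.unop).op ≫ ((Opens.map f).map h'.unop).op) s.1 = _
    rw [F.1.map_comp]; rfl

/-- The inclusion of presheaves `f_! F ⊆ f_* F`. -/
noncomputable def properPresheafι {X Y : TopCat.{0}} (f : Y ⟶ X) (F : SheafR Y) :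
    properPresheaf f F ⟶ ((TopCat.Sheaf.pushforward _ f).obj F).1 where
  app U := ModuleCat.ofHom (properSections f F U.unop).subtype

theorem properPresheaf_isSheaf {X Y : TopCat.{0}} (f : Y ⟶ X) (F : SheafR Y) : (properPresheaf f F).IsSheaf := by
  rw [TopCat.Presheaf.isSheaf_iff_isSheafUniqueGluing]
  intro ι U sf hc
  let G := (TopCat.Sheaf.pushforward (ModuleCat.{0} ℝ) f).obj F
  obtain ⟨s, hs, huniq⟩ := G.existsUnique_gluing U (fun i => (sf i).1)
    (fun i j => congrArg Subtype.val (hc i j))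
  have hmem : s ∈ properSections f F (iSup U) := by
    change ProperOver f _ _
    rw [properOver_iff f.hom.continuous _ (Opens.isOpen _)]
    intro 𝒰 hu x hx hlim
    obtain ⟨i, hi⟩ := Opens.mem_iSup.1 hx
    have hp : ProperOver f (sectionSupport F _ (sf i).1) (U i) := (sf i).2
    have hsi : F.1.map ((Opens.map f).map (Opens.leSupr U i)).op s = (sf i).1 := hs i
    have hsupp : sectionSupport F ((Opens.map f).obj (U i)) (sf i).1 =
        sectionSupport F ((Opens.map f).obj (iSup U)) s ∩ (Opens.map f).obj (U i) := by
      rw [← hsi]; exact sectionSupport_map F _ s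
    rw [hsupp, properOver_iff f.hom.continuous _ (Opens.isOpen _)] at hp
    obtain ⟨y, hy, h2⟩ := hp 𝒰 (Filter.inter_mem hu (hlim ((U i).isOpen.mem_nhds hi))) x hi hlim
    exact ⟨y, hy.1, h2⟩
  refine ⟨⟨s, hmem⟩, fun i => Subtype.ext (hs i), fun t ht => Subtype.ext ?_⟩
  exact huniq t.1 fun i => congrArg Subtype.val (ht i)

/-- The direct image with proper supports `f_! F`. -/
noncomputable def properPushforward {X Y : TopCat.{0}} (f : Y ⟶ X) (F : SheafR Y) : SheafR X :=
  ⟨properPresheaf f F, properPresheaf_isSheaf f F⟩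

/-- The canonical monomorphism `f_! F ⟶ f_* F`. -/
noncomputable def properPushforwardι {X Y : TopCat.{0}} (f : Y ⟶ X) (F : SheafR Y) :
    properPushforward f F ⟶ (TopCat.Sheaf.pushforward _ f).obj F :=
  ⟨properPresheafι f F⟩

/-- The constant sheaf `ℝ_Y`. -/
noncomputable def constSheaf (Y : TopCat.{0}) : SheafR Y :=
  (constantSheaf (Opens.grothendieckTopology Y) (ModuleCat.{0} ℝ)).obj (ModuleCat.of ℝ ℝ)

/-- The whole space is the terminal open set. -/
def opensTopIsTerminal (Y : TopCat.{0}) : Limits.IsTerminal (⊤ : Opens Y) :=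
  Limits.IsTerminal.ofUniqueHom (fun _ => homOfLE le_top) (fun _ _ => rfl)

/-- The canonical morphism `ℝ_X ⟶ i_* ℝ_Y`, corresponding on global sections to `ℝ → Γ(Y, ℝ_Y)`. -/
noncomputable def constSheafRes {X Y : TopCat.{0}} (i : Y ⟶ X) :
    constSheaf X ⟶ (TopCat.Sheaf.pushforward _ i).obj (constSheaf Y) :=
  ((constantSheafAdj (Opens.grothendieckTopology X) (ModuleCat.{0} ℝ)
      (T := ⊤) (opensTopIsTerminal X)).homEquiv _ _).symm
    ((constantSheafAdj (Opens.grothendieckTopology Y) (ModuleCat.{0} ℝ)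
      (T := ⊤) (opensTopIsTerminal Y)).unit.app (ModuleCat.of ℝ ℝ))

/-- A sheaf regarded as an object of the bounded below derived category, in degree `0`. -/
noncomputable abbrev inDegreeZero (Y : TopCat.{0}) : SheafR Y ⥤ DerivedCategory.Plus (SheafR Y) :=
  DerivedCategory.Plus.singleFunctor (SheafR Y) 0

/-- The total right derived functor `R f_*` on bounded below derived categories. -/
noncomputable abbrev derivedPushforward {X Y : TopCat.{0}} (f : Y ⟶ X) :
    DerivedCategory.Plus (SheafR Y) ⥤ DerivedCategory.Plus (SheafR X) :=
  (TopCat.Sheaf.pushforward (ModuleCat.{0} ℝ) f).rightDerivedFunctorPlus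

/-- The canonical morphism `f_* F ⟶ R f_* F`. -/
noncomputable def toDerivedPushforward {X Y : TopCat.{0}} (f : Y ⟶ X) (F : SheafR Y) :
    (inDegreeZero X).obj ((TopCat.Sheaf.pushforward (ModuleCat.{0} ℝ) f).obj F) ⟶
      (derivedPushforward f).obj ((inDegreeZero Y).obj F) :=
  DerivedCategory.Plus.Qh.map (ObjectProperty.homMk
    ((HomotopyCategory.quotient (SheafR X) (ComplexShape.up ℤ)).map
      ((HomologicalComplex.singleMapHomologicalComplex
        (TopCat.Sheaf.pushforward (ModuleCat.{0} ℝ) f) (ComplexShape.up ℤ) 0).inv.app F)) :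
      (HomotopyCategory.Plus.singleFunctor (SheafR X) 0).obj
          ((TopCat.Sheaf.pushforward (ModuleCat.{0} ℝ) f).obj F) ⟶
        (TopCat.Sheaf.pushforward (ModuleCat.{0} ℝ) f).mapHomotopyCategoryPlus.obj
          ((HomotopyCategory.Plus.singleFunctor (SheafR Y) 0).obj F)) ≫
  (TopCat.Sheaf.pushforward (ModuleCat.{0} ℝ) f).rightDerivedFunctorPlusUnit.app
    ((HomotopyCategory.Plus.singleFunctor (SheafR Y) 0).obj F)

/-- For continuous maps `i : U ⟶ Y`, `ι : Y ⟶ X` with composite `j`, the canonical morphism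
`ι_! ℝ_Y ⟶ ι_* ℝ_Y ⟶ ι_* i_* ℝ_U = j_* ℝ_U ⟶ R j_* ℝ_U`. -/
noncomputable def comparison {U Y X : TopCat.{0}} (i : U ⟶ Y) (ι : Y ⟶ X) (j : U ⟶ X)
    (h : i ≫ ι = j) :
    (inDegreeZero X).obj (properPushforward ι (constSheaf Y)) ⟶
      (derivedPushforward j).obj ((inDegreeZero U).obj (constSheaf U)) :=
  (inDegreeZero X).map
    (properPushforwardι ι (constSheaf Y) ≫
      (TopCat.Sheaf.pushforward (ModuleCat.{0} ℝ) ι).map (constSheafRes i) ≫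
      eqToHom (by subst h; rfl :
        (TopCat.Sheaf.pushforward (ModuleCat.{0} ℝ) ι).obj
            ((TopCat.Sheaf.pushforward (ModuleCat.{0} ℝ) i).obj (constSheaf U)) =
          (TopCat.Sheaf.pushforward (ModuleCat.{0} ℝ) j).obj (constSheaf U))) ≫
  toDerivedPushforward j (constSheaf U)

end TropicalComplement

/-! The circuits of the two uniform matroids are known: `U_{n+1,n+1}` has none and `U_{n,n+1}` has
only the ground set. So `X` is the whole torus, and a class lies outside `D` iff a single coordinate
`v k` is the strict maximum. In the coordinates `v k - v l`, `l ≠ k`, these classes form the open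
positive orthant. Hence the complement of `D` is a disjoint union of `n + 1` open orthants, which
are its components, and their closures are closed orthants (`isOrthantUnion_compl_D`).

Balls meet open and closed orthants in convex sets, which gives local asphericity and makes `ℝ → i_*
ℝ` an isomorphism (`isIso_constSheafRes`). As there are finitely many closed pieces, `ι` is proper
and `ι_! = ι_*` (`isIso_properPushforwardι`).

What remains is `j_* ℝ ≅ R j_* ℝ`. The cube about a point of `X` in the `k`-th chart cuts the `k`-th
orthant in an open box, so it suffices that the constant sheaf has no higher cohomology on boxes.
This is proved directly on an injective resolution. Injective sheaves are flasque, so all sections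
may be taken global. By induction on the degree, cocycles on a box extend to global cocycles
(`cocyclesExtend`): in degree zero they are constants, and in higher degrees they have primitives on
the box (`exists_primitive_on_box`). Local primitives are glued across overlapping subboxes after
correction by global cocycles, first on compactly contained boxes (`box_induction_compact`), then
along an exhaustion. -/

namespace TropicalComplement

/-! ### Induction over boxes by repeated bisection. -/

section Boxes

/-- A property of boxes in `ℝⁿ` which passes to smaller boxes, holds locally, and can be glued
along each coordinate, holds for every compact subbox of an open box on which it holds locally. -/
theorem box_induction_compact {n : ℕ} {T : (Fin n → ℝ) → (Fin n → ℝ) → Prop}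
    (mono : ∀ a b a' b', a ≤ a' → b' ≤ b → T a b → T a' b')
    (glue : ∀ a b i c d, c < d → T a (Function.update b i d) → T (Function.update a i c) b → T a b)
    {a b : Fin n → ℝ} (hab : a ≤ b)
    (loc : ∀ x ∈ Set.Icc a b, ∃ ε > 0, T (fun i => x i - ε) (fun i => x i + ε)) : T a b := by
  choose! ε hε hT using loc
  obtain ⟨δ, hδ, hδT⟩ := lebesgue_number_lemma_of_metric (isCompact_Icc (a := a) (b := b))
    (c := fun x : Set.Icc a b => Metric.ball x.1 (ε x.1 / 2)) (fun _ => Metric.isOpen_ball)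
    (fun x hx => Set.mem_iUnion.2 ⟨⟨x, hx⟩, Metric.mem_ball_self (half_pos (hε x hx))⟩)
  -- Here `s` is the set of directions in which the box may be long; in the others its side is below
  -- the Lebesgue scale. The margin `η` makes neighbouring boxes overlap.
  have key : ∀ s : Finset (Fin n), ∀ a' b', a ≤ a' → a' ≤ b' → b' ≤ b →
      (∀ i ∉ s, b' i - a' i ≤ δ / 2) →
      ∃ η > 0, T (fun i => a' i - η) (fun i => b' i + η) := by
    intro s
    induction s using Finset.induction_on with
    | empty =>
      intro a' b' h1 h2 h3 h4
      obtain ⟨x, hx⟩ := hδT a' ⟨h1, h2.trans h3⟩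
      have hxa := hx (Metric.mem_ball_self hδ)
      have hxb : b' ∈ Metric.ball x.1 (ε x.1 / 2) := by
        refine hx (lt_of_le_of_lt ?_ (half_lt_self hδ))
        refine (dist_pi_le_iff (half_pos hδ).le).2 fun i => ?_
        rw [Real.dist_eq, abs_of_nonneg (sub_nonneg.2 (h2 i))]
        exact h4 i (Finset.notMem_empty i)
      have hx0 := half_pos (hε x.1 x.2)
      rw [Metric.mem_ball, dist_pi_lt_iff hx0] at hxa hxb
      -- Both corners are within `ε / 2` of `x`, so a further margin of `ε / 2` stays in the box on
      -- which `T` is known.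
      refine ⟨ε x.1 / 2, hx0, mono _ _ _ _ (fun i => ?_) (fun i => ?_) (hT x.1 x.2)⟩
      · have := (abs_lt.1 (hxa i)).1
        dsimp only
        linarith
      · have := (abs_lt.1 (hxb i)).2
        dsimp only
        linarith
    | insert j s hj ih =>
      -- `m` bisections in direction `j` bring that side below `δ / 2`.
      have step : ∀ m : ℕ, ∀ a' b', a ≤ a' → a' ≤ b' → b' ≤ b →
          (∀ i ∉ insert j s, b' i - a' i ≤ δ / 2) → b' j - a' j ≤ 2 ^ m * (δ / 2) →
          ∃ η > 0, T (fun i => a' i - η) (fun i => b' i + η) := by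
        intro m
        induction m with
        | zero =>
          intro a' b' h1 h2 h3 h4 h5
          refine ih a' b' h1 h2 h3 fun i hi => ?_
          by_cases hij : i = j
          · subst hij; simpa using h5
          · exact h4 i (by simp [hij, hi])
        | succ m ihm =>
          intro a' b' h1 h2 h3 h4 h5
          set c := (a' j + b' j) / 2 with hc
          have h2j := h2 j
          have hca : a' j ≤ c := by linarith
          have hcb : c ≤ b' j := by linarith
          have hba : Function.update b' j c ≤ b' := update_le_self_iff.2 hcb
          have haa : a' ≤ Function.update a' j c := le_update_self_iff.2 hca
          obtain ⟨η₁, h₁, t₁⟩ := ihm a' (Function.update b' j c) h1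
            (le_update_iff.2 ⟨hca, fun i _ => h2 i⟩) (hba.trans h3)
            (fun i hi => by
              rw [Function.update_of_ne (fun h => hi (by simp [h]))]; exact h4 i hi)
            (by rw [Function.update_self, hc]; rw [pow_succ] at h5; linarith)
          obtain ⟨η₂, h₂, t₂⟩ := ihm (Function.update a' j c) b' (h1.trans haa)
            (update_le_iff.2 ⟨hcb, fun i _ => h2 i⟩) h3
            (fun i hi => by
              rw [Function.update_of_ne (fun h => hi (by simp [h]))]; exact h4 i hi)
            (by rw [Function.update_self, hc]; rw [pow_succ] at h5; linarith)
          refine ⟨min η₁ η₂, lt_min h₁ h₂, glue _ _ j (c - min η₁ η₂) (c + min η₁ η₂)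
            (by linarith [lt_min h₁ h₂]) (mono _ _ _ _ ?_ ?_ t₁) (mono _ _ _ _ ?_ ?_ t₂)⟩
          · intro i; exact sub_le_sub_left (min_le_left _ _) _
          · intro i
            by_cases hij : i = j
            · subst hij; simp
            · simp [hij]
          · intro i
            by_cases hij : i = j
            · subst hij; simp only [Function.update_self]; linarith [min_le_right η₁ η₂]
            · simp only [Function.update_of_ne hij]; linarith [min_le_right η₁ η₂]
          · intro i; exact add_le_add_right (min_le_right _ _) _
      intro a' b' h1 h2 h3 h4
      obtain ⟨m, hm⟩ := pow_unbounded_of_one_lt ((b' j - a' j) / (δ / 2)) one_lt_two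
      exact step m a' b' h1 h2 h3 h4 ((div_le_iff₀ (half_pos hδ)).1 hm.le)
  obtain ⟨η, hη, h⟩ := key Finset.univ a b le_rfl hab le_rfl (by simp)
  exact mono _ _ _ _ (fun i => by dsimp only; linarith) (fun i => by dsimp only; linarith) h

end Boxes

/-! ### Sections of sheaves: free sheaves, flasqueness, local exactness. -/

section Sections

variable {Y : TopCat.{0}}

/-- The sections of `F` over `U`. -/
abbrev Sec (F : SheafR Y) (U : Opens Y) : Type := F.1.obj (op U)

/-- Restriction of sections. -/
def res (F : SheafR Y) {U V : Opens Y} (h : V ≤ U) : Sec F U →ₗ[ℝ] Sec F V :=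
  (F.1.map (homOfLE h).op).hom

/-- The effect of a morphism of sheaves on sections. -/
def appSec {F G : SheafR Y} (φ : F ⟶ G) (U : Opens Y) : Sec F U →ₗ[ℝ] Sec G U :=
  (φ.hom.app (op U)).hom

@[simp] theorem res_res (F : SheafR Y) {U V W : Opens Y} (h : V ≤ U) (h' : W ≤ V) (s : Sec F U) :
    res F h' (res F h s) = res F (h'.trans h) s :=
  (congrArg (fun f : F.1.obj (op U) ⟶ F.1.obj (op W) => f.hom s)
    (F.1.map_comp (homOfLE h).op (homOfLE h').op)).symm

@[simp] theorem appSec_comp {F G H : SheafR Y} (φ : F ⟶ G) (ψ : G ⟶ H) (U : Opens Y)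
    (s : Sec F U) : appSec (φ ≫ ψ) U s = appSec ψ U (appSec φ U s) := rfl

@[simp] theorem appSec_zero {F G : SheafR Y} (U : Opens Y) (s : Sec F U) :
    appSec (0 : F ⟶ G) U s = 0 := rfl

theorem appSec_res {F G : SheafR Y} (φ : F ⟶ G) {U V : Opens Y} (h : V ≤ U) (s : Sec F U) :
    appSec φ V (res F h s) = res G h (appSec φ U s) :=
  congrArg (fun f : F.1.obj (op U) ⟶ G.1.obj (op V) => f.hom s)
    (φ.hom.naturality (homOfLE h).op)

theorem eq_of_locally_eq (F : SheafR Y) {U : Opens Y} (s t : Sec F U)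
    (h : ∀ y ∈ U, ∃ V : Opens Y, ∃ hV : V ≤ U, y ∈ V ∧ res F hV s = res F hV t) : s = t := by
  choose V hV hy hs using h
  exact F.eq_of_locally_eq' (fun y : U => V y.1 y.2) U (fun y => homOfLE (hV _ _))
    (fun y hyU => Opens.mem_iSup.2 ⟨⟨y, hyU⟩, hy y hyU⟩) s t (fun y => hs y.1 y.2)

theorem exists_gluing (F : SheafR Y) {ι : Type} {U : Opens Y} (V : ι → Opens Y)
    (hV : ∀ i, V i ≤ U) (hU : U ≤ iSup V) (s : ∀ i, Sec F (V i))
    (h : ∀ i j, res F (inf_le_left : V i ⊓ V j ≤ V i) (s i) =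
      res F (inf_le_right : V i ⊓ V j ≤ V j) (s j)) :
    ∃ t : Sec F U, ∀ i, res F (hV i) t = s i :=
  (F.existsUnique_gluing' V U (fun i => homOfLE (hV i)) hU s h).exists

theorem isIso_of_appSec_bijective {F G : SheafR Y} (φ : F ⟶ G)
    (h : ∀ U, Function.Bijective (appSec φ U)) : IsIso φ := by
  have : ∀ U, IsIso (φ.hom.app U) := fun U =>
    (ConcreteCategory.isIso_iff_bijective _).2 (h U.unop)
  have h1 : IsIso ((TopCat.Sheaf.forget (ModuleCat.{0} ℝ) Y).map φ) := NatIso.isIso_of_isIso_app φ.hom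
  exact isIso_of_reflects_iso φ (TopCat.Sheaf.forget (ModuleCat.{0} ℝ) Y)

theorem epi_iff_locallySurjective {F G : SheafR Y} (φ : F ⟶ G) :
    Epi φ ↔ ∀ (U : Opens Y) (t : Sec G U), ∀ y ∈ U, ∃ (V : Opens Y) (hV : V ≤ U) (s : Sec F V),
      y ∈ V ∧ appSec φ V s = res G hV t := by
  rw [← TopCat.Sheaf.isLocallySurjective_iff_epi, TopCat.Presheaf.isLocallySurjective_iff]
  refine forall₄_congr fun U t y hy => ?_
  constructor
  · rintro ⟨V, hV, ⟨s, hs⟩, hyV⟩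
    exact ⟨V, hV, s, hyV, hs⟩
  · rintro ⟨V, hV, s, hyV, hs⟩
    exact ⟨V, hV, ⟨s, hs⟩, hyV⟩

theorem mono_of_appSec_injective_iff {F G : SheafR Y} (φ : F ⟶ G) :
    Mono φ ↔ ∀ U, Function.Injective (appSec φ U) := by
  constructor
  · intro h U
    have h1 : Mono ((TopCat.Sheaf.forget (ModuleCat.{0} ℝ) Y).map φ) := Functor.map_mono _ _
    have h2 := (NatTrans.mono_iff_mono_app _).1 h1 (op U)
    exact (ModuleCat.mono_iff_injective _).1 h2
  · intro h
    have h2 : ∀ U, Mono (((TopCat.Sheaf.forget (ModuleCat.{0} ℝ) Y).map φ).app U) := fun U =>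
      (ModuleCat.mono_iff_injective _).2 (h U.unop)
    have : Mono ((TopCat.Sheaf.forget (ModuleCat.{0} ℝ) Y).map φ) := NatTrans.mono_of_mono_app _
    exact (TopCat.Sheaf.forget (ModuleCat.{0} ℝ) Y).mono_of_mono_map this

/-- The free presheaf of real vector spaces on the presheaf represented by `U`. -/
noncomputable def freePresheaf (U : Opens Y) : TopCat.Presheaf (ModuleCat.{0} ℝ) Y :=
  yoneda.obj U ⋙ ModuleCat.free ℝ

/-- The free sheaf of real vector spaces on `U`. -/
noncomputable def freeSheaf (U : Opens Y) : SheafR Y :=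
  (presheafToSheaf (Opens.grothendieckTopology Y) (ModuleCat.{0} ℝ)).obj (freePresheaf U)

/-- The tautological section of the free sheaf on `U`. -/
noncomputable def freeSection (U : Opens Y) : Sec (freeSheaf U) U :=
  (toSheafify (Opens.grothendieckTopology Y) (freePresheaf U)).app (op U)
    (ModuleCat.freeMk (R := ℝ) (𝟙 U))

/-- Morphisms out of the free sheaf on `U` with a prescribed value. -/
theorem exists_appSec_freeSection {F : SheafR Y} {U : Opens Y} (s : Sec F U) :
    ∃ φ : freeSheaf U ⟶ F, appSec φ U (freeSection U) = s := by
  let ψ : freePresheaf U ⟶ F.1 :=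
    { app V := ModuleCat.freeDesc (TypeCat.ofHom fun h : V.unop ⟶ U => F.1.map h.op s)
      naturality {V W} f := by
        apply ModuleCat.free_hom_ext
        intro h
        change ModuleCat.freeDesc _ ((ModuleCat.free ℝ).map ((yoneda.obj U).map f)
          (ModuleCat.freeMk h)) = F.1.map f (ModuleCat.freeDesc _ (ModuleCat.freeMk h))
        rw [ModuleCat.free_map_apply, ModuleCat.freeDesc_apply, ModuleCat.freeDesc_apply]
        exact congrArg (fun g : F.1.obj (op U) ⟶ F.1.obj W => g.hom s)
          (F.1.map_comp (Quiver.Hom.op h) f) }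
  refine ⟨⟨sheafifyLift _ ψ F.2⟩, ?_⟩
  have h1 := congrArg (fun g : freePresheaf U ⟶ F.1 =>
    (g.app (op U)).hom (ModuleCat.freeMk (R := ℝ) (𝟙 U)))
    (toSheafify_sheafifyLift (Opens.grothendieckTopology Y) ψ F.2)
  refine h1.trans ((ModuleCat.freeDesc_apply _ _).trans ?_)
  exact congrArg (fun g : F.1.obj (op U) ⟶ F.1.obj (op U) => g.hom s) (F.1.map_id (op U))

/-- Every generator of the free presheaf is a restriction of the tautological section. With
`exists_appSec_freeSection`, this says that the free sheaf represents sections over `U`. -/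
theorem freeSheaf_hom_eq_zero {F : SheafR Y} {U : Opens Y} (φ : freeSheaf U ⟶ F)
    (h : appSec φ U (freeSection U) = 0) : φ = 0 := by
  apply ObjectProperty.hom_ext
  apply sheafify_hom_ext (Opens.grothendieckTopology Y) _ _ F.2
  ext1
  ext1 V
  apply ModuleCat.free_hom_ext
  intro f
  have h1 : (toSheafify (Opens.grothendieckTopology Y) (freePresheaf U)).app V
      (ModuleCat.freeMk (R := ℝ) f) =
      res (freeSheaf U) (leOfHom f : V.unop ≤ U) (freeSection U) := by
    have := congrArg (fun g : (freePresheaf U).obj (op U) ⟶ _ =>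
      g.hom (ModuleCat.freeMk (R := ℝ) (𝟙 U)))
      ((toSheafify (Opens.grothendieckTopology Y) (freePresheaf U)).naturality
        (Quiver.Hom.op f : op U ⟶ V))
    refine Eq.trans ?_ this
    change _ = (toSheafify (Opens.grothendieckTopology Y) (freePresheaf U)).app V
      ((ModuleCat.free ℝ).map ((yoneda.obj U).map (Quiver.Hom.op f : op U ⟶ V))
        (ModuleCat.freeMk (𝟙 U)))
    rw [ModuleCat.free_map_apply]
    rfl
  refine (congrArg (appSec φ V.unop) h1).trans ?_
  rw [appSec_res, h, map_zero]
  rfl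

/-- The morphism of free sheaves given by an inclusion. -/
noncomputable def freeSheafMap {U V : Opens Y} (h : U ≤ V) : freeSheaf U ⟶ freeSheaf V :=
  (presheafToSheaf (Opens.grothendieckTopology Y) (ModuleCat.{0} ℝ)).map
    (Functor.whiskerRight (yoneda.map (homOfLE h)) (ModuleCat.free ℝ))

/-- Hom sets between open sets have at most one element, so the map is injective on presheaves, and
sheafification preserves monomorphisms. -/
instance {U V : Opens Y} (h : U ≤ V) : Mono (freeSheafMap h) := by
  have : ∀ W, Mono ((Functor.whiskerRight (yoneda.map (homOfLE h)) (ModuleCat.free ℝ)).app W) := by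
    intro W
    refine (ModuleCat.mono_iff_injective _).2 ?_
    exact Finsupp.mapDomain_injective
      (fun _ _ _ => (inferInstance : Subsingleton (W.unop ⟶ U)).elim _ _)
  have : Mono (Functor.whiskerRight (yoneda.map (homOfLE h)) (ModuleCat.free ℝ)) :=
    NatTrans.mono_of_mono_app _
  exact (inferInstance : Mono ((presheafToSheaf (Opens.grothendieckTopology Y)
    (ModuleCat.{0} ℝ)).map (Functor.whiskerRight (yoneda.map (homOfLE h)) (ModuleCat.free ℝ))))

theorem appSec_freeSheafMap {U V : Opens Y} (h : U ≤ V) :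
    appSec (freeSheafMap h) U (freeSection U) = res _ h (freeSection V) := by
  have h1 := congrArg (fun g : freePresheaf U ⟶ _ =>
    (g.app (op U)).hom (ModuleCat.freeMk (R := ℝ) (𝟙 U)))
    (toSheafify_naturality (Opens.grothendieckTopology Y)
      (Functor.whiskerRight (yoneda.map (homOfLE h)) (ModuleCat.free ℝ)))
  refine Eq.trans h1.symm ?_
  have h2 := congrArg (fun g : (freePresheaf V).obj (op V) ⟶ _ =>
      g.hom (ModuleCat.freeMk (R := ℝ) (𝟙 V)))
      ((toSheafify (Opens.grothendieckTopology Y) (freePresheaf V)).naturality (homOfLE h).op)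
  refine Eq.trans ?_ h2
  change (toSheafify (Opens.grothendieckTopology Y) (freePresheaf V)).app (op U)
      ((ModuleCat.free ℝ).map ((yoneda.map (homOfLE h)).app (op U)) (ModuleCat.freeMk (𝟙 U))) =
    (toSheafify (Opens.grothendieckTopology Y) (freePresheaf V)).app (op U)
      ((ModuleCat.free ℝ).map ((yoneda.obj V).map (homOfLE h).op) (ModuleCat.freeMk (𝟙 V)))
  rw [ModuleCat.free_map_apply, ModuleCat.free_map_apply]
  rfl

/-- Injective sheaves are flasque. -/
theorem res_surjective_of_injective (I : SheafR Y) [Injective I] {U V : Opens Y} (h : U ≤ V) :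
    Function.Surjective (res I h) := by
  intro s
  obtain ⟨φ, hφ⟩ := exists_appSec_freeSection s
  -- Extending a section from `U` to `V` means extending a morphism along the monomorphism of free
  -- sheaves.
  refine ⟨appSec (Injective.factorThru φ (freeSheafMap h)) V (freeSection V), ?_⟩
  rw [← appSec_res, ← appSec_freeSheafMap, ← appSec_comp, Injective.comp_factorThru, hφ]

/-- For the forward direction, a section is a morphism from a free sheaf; exactness lifts it after
an epimorphism, and epimorphisms of sheaves are locally surjective. -/
theorem exact_iff_locally_exact (S : ShortComplex (SheafR Y)) :
    S.Exact ↔ ∀ (U : Opens Y) (s : Sec S.X₂ U), appSec S.g U s = 0 → ∀ y ∈ U,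
      ∃ (V : Opens Y) (hV : V ≤ U) (t : Sec S.X₁ V), y ∈ V ∧ appSec S.f V t = res S.X₂ hV s := by
  constructor
  · intro hS U s hs y hy
    obtain ⟨φ, rfl⟩ := exists_appSec_freeSection s
    have h0 : φ ≫ S.g = 0 := freeSheaf_hom_eq_zero _ hs
    obtain ⟨A, π, hπ, x, hx⟩ := (ShortComplex.exact_iff_exact_up_to_refinements S).1 hS φ h0
    obtain ⟨V, hV, a, hyV, ha⟩ := (epi_iff_locallySurjective π).1 hπ U (freeSection U) y hy
    refine ⟨V, hV, appSec x V a, hyV, ?_⟩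
    rw [← appSec_comp, ← hx, appSec_comp, ha, appSec_res]
  · intro h
    rw [S.exact_iff_epi_toCycles, epi_iff_locallySurjective]
    intro U c y hy
    obtain ⟨V, hV, t, hyV, ht⟩ := h U (appSec S.iCycles U c)
      (by rw [← appSec_comp, S.iCycles_g, appSec_zero]) y hy
    refine ⟨V, hV, t, hyV, (mono_of_appSec_injective_iff S.iCycles).1 inferInstance V ?_⟩
    rw [← appSec_comp, S.toCycles_i, ht, appSec_res]

theorem exists_section_of_exact_of_mono {S : ShortComplex (SheafR Y)} (hS : S.Exact) [Mono S.f]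
    {U : Opens Y} (s : Sec S.X₂ U) (hs : appSec S.g U s = 0) :
    ∃ t : Sec S.X₁ U, appSec S.f U t = s := by
  obtain ⟨φ, rfl⟩ := exists_appSec_freeSection s
  have h0 : φ ≫ S.g = 0 := freeSheaf_hom_eq_zero _ hs
  exact ⟨appSec (hS.lift φ h0) U (freeSection U), by rw [← appSec_comp, hS.lift_f]⟩

end Sections

/-! ### The constant sheaf and the first two arrows of the comparison. -/

section Constant

variable {Y : TopCat.{0}}

/-- The section of the constant sheaf given by a real number. -/
noncomputable def constSection (U : Opens Y) (r : ℝ) : Sec (constSheaf Y) U :=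
  (toSheafify (Opens.grothendieckTopology Y)
    ((Functor.const (Opens Y)ᵒᵖ).obj (ModuleCat.of ℝ ℝ))).app (op U) r

theorem res_constSection {U V : Opens Y} (h : V ≤ U) (r : ℝ) :
    res (constSheaf Y) h (constSection U r) = constSection V r :=
  (congrArg (fun g : ModuleCat.of ℝ ℝ ⟶ _ => g.hom r)
    ((toSheafify (Opens.grothendieckTopology Y)
      ((Functor.const (Opens Y)ᵒᵖ).obj (ModuleCat.of ℝ ℝ))).naturality (homOfLE h).op)).symm

/-- Equality after sheafification is local equality in the constant presheaf; a point of `U`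
supplies an open set on which to read it off. -/
theorem constSection_injective {U : Opens Y} (hU : (U : Set Y).Nonempty) :
    Function.Injective (constSection U) := by
  intro r r' h
  obtain ⟨y, hy⟩ := hU
  have h1 := Presheaf.equalizerSieve_mem (Opens.grothendieckTopology Y)
    (toSheafify (Opens.grothendieckTopology Y)
      ((Functor.const (Opens Y)ᵒᵖ).obj (ModuleCat.of ℝ ℝ))) (X := op U) r r' h
  obtain ⟨V, f, hf, -⟩ := h1 y hy
  exact hf

theorem exists_locally_eq_constSection {U : Opens Y} (s : Sec (constSheaf Y) U) {y : Y}
    (hy : y ∈ U) : ∃ (V : Opens Y) (hV : V ≤ U) (r : ℝ), y ∈ V ∧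
      res (constSheaf Y) hV s = constSection V r := by
  have h1 : TopCat.Presheaf.IsLocallySurjective (toSheafify (Opens.grothendieckTopology Y)
      ((Functor.const (Opens Y)ᵒᵖ).obj (ModuleCat.of ℝ ℝ))) :=
    Presheaf.isLocallySurjective_toSheafify' _ _
  obtain ⟨V, hV, ⟨r, hr⟩, hyV⟩ := (TopCat.Presheaf.isLocallySurjective_iff _).1 h1 U s y hy
  exact ⟨V, hV, r, hyV, hr.symm⟩

theorem exists_eq_constSection {U : Opens Y} (hU : IsPreconnected (U : Set Y))
    (s : Sec (constSheaf Y) U) : ∃ r, s = constSection U r := by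
  rcases (U : Set Y).eq_empty_or_nonempty with h0 | ⟨y₀, hy₀⟩
  · refine ⟨0, eq_of_locally_eq _ _ _ fun y hy => ?_⟩
    exact absurd (show y ∈ (U : Set Y) from hy) (by simp [h0])
  obtain ⟨V₀, hV₀, r₀, hyV₀, hr₀⟩ := exists_locally_eq_constSection s hy₀
  refine ⟨r₀, ?_⟩
  -- The points near which `s` is constant with value satisfying `P`. The sets for `= r₀` and `≠ r₀`
  -- are open, cover `U` and cannot meet, so connectedness excludes the second.
  let A (P : ℝ → Prop) : Set Y := {y | ∃ (V : Opens Y) (hV : V ≤ U) (r : ℝ), P r ∧ y ∈ V ∧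
    res (constSheaf Y) hV s = constSection V r}
  have hA : ∀ P, IsOpen (A P) := fun P => isOpen_iff_mem_nhds.2 fun y ⟨V, hV, r, hP, hy, hr⟩ =>
    Filter.mem_of_superset (V.isOpen.mem_nhds hy) fun z hz => ⟨V, hV, r, hP, hz, hr⟩
  have hcov : (U : Set Y) ⊆ A (· = r₀) ∪ A (· ≠ r₀) := by
    intro y hy
    obtain ⟨V, hV, r, hyV, hr⟩ := exists_locally_eq_constSection s hy
    by_cases h : r = r₀
    · exact Or.inl ⟨V, hV, r, h, hyV, hr⟩
    · exact Or.inr ⟨V, hV, r, h, hyV, hr⟩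
  have hne : ∀ y ∈ U, y ∉ A (· ≠ r₀) := by
    intro y hy hyA
    obtain ⟨z, -, ⟨V, hV, r, rfl, hzV, hr⟩, ⟨V', hV', r', hr'₀, hzV', hr'⟩⟩ := hU _ _ (hA _) (hA _)
      hcov ⟨y₀, hy₀, V₀, hV₀, r₀, rfl, hyV₀, hr₀⟩ ⟨y, hy, hyA⟩
    refine hr'₀ (constSection_injective (U := V ⊓ V') ⟨z, hzV, hzV'⟩ ?_)
    rw [← res_constSection inf_le_right, ← res_constSection inf_le_left, ← hr, ← hr']
    simp
  refine eq_of_locally_eq _ _ _ fun y hy => ?_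
  obtain ⟨V, hV, r, rfl, hyV, hr⟩ := (hcov hy).resolve_right (hne y hy)
  exact ⟨V, hV, hyV, by rw [hr, res_constSection]⟩

theorem constantSheafAdj_unit_app (Y : TopCat.{0}) :
    (constantSheafAdj (Opens.grothendieckTopology Y) (ModuleCat.{0} ℝ) (T := ⊤)
      (opensTopIsTerminal Y)).unit.app (ModuleCat.of ℝ ℝ) =
      (toSheafify (Opens.grothendieckTopology Y)
        ((Functor.const (Opens Y)ᵒᵖ).obj (ModuleCat.of ℝ ℝ))).app (op ⊤) := by
  rw [constantSheafAdj, Adjunction.comp_unit_app]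
  rfl

theorem constantSheafAdj_homEquiv_symm_comp
    (G : Sheaf (Opens.grothendieckTopology Y) (ModuleCat.{0} ℝ))
    (f : ModuleCat.of ℝ ℝ ⟶ G.1.obj (op ⊤)) :
    (toSheafify (Opens.grothendieckTopology Y)
        ((Functor.const (Opens Y)ᵒᵖ).obj (ModuleCat.of ℝ ℝ))).app (op ⊤) ≫
      (((constantSheafAdj (Opens.grothendieckTopology Y) (ModuleCat.{0} ℝ) (T := ⊤)
        (opensTopIsTerminal Y)).homEquiv (ModuleCat.of ℝ ℝ) G).symm f).hom.app (op ⊤) = f := by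
  have h1 := ((constantSheafAdj (Opens.grothendieckTopology Y) (ModuleCat.{0} ℝ)
    (T := ⊤) (opensTopIsTerminal Y)).homEquiv (ModuleCat.of ℝ ℝ) G).apply_symm_apply f
  rwa [Adjunction.homEquiv_unit, constantSheafAdj_unit_app] at h1

/-- The adjunction determines the morphism on global constants; other open sets follow by
restriction. -/
theorem appSec_constSheafRes {X : TopCat.{0}} (i : Y ⟶ X) (U : Opens X) (r : ℝ) :
    appSec (constSheafRes i) U (constSection U r) = constSection ((Opens.map i).obj U) r := by
  have htop : appSec (constSheafRes i) ⊤ (constSection ⊤ r) = constSection (Y := Y) ⊤ r := by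
    have h1 := constantSheafAdj_homEquiv_symm_comp
      ((TopCat.Sheaf.pushforward (ModuleCat.{0} ℝ) i).obj (constSheaf Y))
      ((constantSheafAdj (Opens.grothendieckTopology Y) (ModuleCat.{0} ℝ) (T := ⊤)
        (opensTopIsTerminal Y)).unit.app (ModuleCat.of ℝ ℝ))
    refine (congrArg (fun g : ModuleCat.of ℝ ℝ ⟶ _ => g.hom r) h1).trans ?_
    exact congrArg (fun g : ModuleCat.of ℝ ℝ ⟶ _ => g.hom r) (constantSheafAdj_unit_app Y)
  rw [← res_constSection le_top, appSec_res, htop]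
  exact res_constSection (Y := Y) le_top r

/-- Restriction of the constant sheaf along a locally aspheric map is an isomorphism. -/
theorem isIso_constSheafRes {X : TopCat.{0}} (i : Y ⟶ X) (hi : LocallyAspheric i) :
    IsIso (constSheafRes i) := by
  -- Of asphericity only connectedness of `V` and of its preimage is needed: sections over both are
  -- then single constants.
  have key : ∀ (U : Opens X), ∀ x ∈ U, ∃ V : Opens X, V ≤ U ∧ x ∈ V ∧
      IsPreconnected (V : Set X) ∧ IsConnected (((Opens.map i).obj V : Opens Y) : Set Y) := by
    intro U x hx
    obtain ⟨V, hVo, hxV, hVU, h1, h2⟩ := hi x U (U.isOpen.mem_nhds hx)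
    exact ⟨⟨V, hVo⟩, hVU, hxV, isPreconnected_iff_preconnectedSpace.2 inferInstance,
      isConnected_iff_connectedSpace.2
        (inferInstance : ConnectedSpace ((i : Y → X) ⁻¹' V))⟩
  have hinj : ∀ U, Function.Injective (appSec (constSheafRes i) U) := by
    intro U
    rw [injective_iff_map_eq_zero]
    intro s hs
    refine eq_of_locally_eq _ _ _ fun x hx => ?_
    obtain ⟨V, hVU, hxV, h1, h2⟩ := key U x hx
    refine ⟨V, hVU, hxV, ?_⟩
    obtain ⟨r, hr⟩ := exists_eq_constSection h1 (res _ hVU s)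
    have h3 : constSection ((Opens.map i).obj V) r = constSection ((Opens.map i).obj V) 0 := by
      rw [← appSec_constSheafRes, ← hr, appSec_res, hs, map_zero]
      exact (map_zero ((toSheafify (Opens.grothendieckTopology Y)
        ((Functor.const (Opens Y)ᵒᵖ).obj (ModuleCat.of ℝ ℝ))).app _).hom).symm
    rw [hr, constSection_injective h2.1 h3, map_zero]
    exact map_zero ((toSheafify (Opens.grothendieckTopology X)
        ((Functor.const (Opens X)ᵒᵖ).obj (ModuleCat.of ℝ ℝ))).app _).hom
  have : Mono (constSheafRes i) := (mono_of_appSec_injective_iff _).2 hinj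
  have : Epi (constSheafRes i) := by
    rw [epi_iff_locallySurjective]
    intro U t x hx
    obtain ⟨V, hVU, hxV, h1, h2⟩ := key U x hx
    obtain ⟨r, hr⟩ := exists_eq_constSection h2.isPreconnected
      (res (constSheaf Y) ((Opens.map i).monotone hVU) t)
    exact ⟨V, hVU, constSection V r, hxV, (appSec_constSheafRes i V r).trans hr.symm⟩
  exact isIso_of_mono_of_epi _

/-- For a proper map the direct image with proper supports is the direct image. -/
theorem isIso_properPushforwardι {X : TopCat.{0}} (f : Y ⟶ X) (hf : IsProperMap f)
    (F : SheafR Y) : IsIso (properPushforwardι f F) := by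
  refine isIso_of_appSec_bijective _ fun U => ⟨Subtype.val_injective, fun s => ⟨⟨s, ?_⟩, rfl⟩⟩
  change ProperOver f _ _
  rw [properOver_iff f.hom.continuous _ U.isOpen]
  intro 𝒰 hS x hx hlim
  obtain ⟨y, hyx, hle⟩ := (isProperMap_iff_ultrafilter.1 hf).2 hlim
  refine ⟨y, ⟨?_, ?_⟩, hyx, hle⟩
  · change f y ∈ U
    rw [hyx]; exact hx
  -- The support is relatively closed: `𝒰` contains both it and every neighbourhood of `y`.
  · intro V hV hyV h0
    obtain ⟨z, hz, hzV⟩ := 𝒰.nonempty_of_mem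
      (Filter.inter_mem hS (hle (V.isOpen.mem_nhds hyV)))
    exact hz.2 V hV hzV h0

end Constant

/-! ### Computing the derived functor from an acyclic injective resolution. -/

section Derived

variable {C D : Type*} [Category* C] [Category* D] [Abelian C] [Abelian D]

/-- A left exact functor sends the augmentation of an injective resolution to a quasi-isomorphism
as soon as the image of the resolution is exact in positive degrees. -/
theorem quasiIso_map_resolution (F : C ⥤ D) [F.Additive] [Limits.PreservesFiniteLimits F]
    {A : C} (R : InjectiveResolution A)
    (hex : ∀ p : ℕ, ((F.mapHomologicalComplex (ComplexShape.up ℤ)).obj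
      R.cochainComplex).ExactAt (p + 1 : ℤ)) :
    QuasiIso ((F.mapHomologicalComplex (ComplexShape.up ℤ)).map R.ι') := by
  rw [quasiIso_iff]
  intro n
  have hsrc : ∀ i : ℤ, i ≠ 0 → Limits.IsZero (((CochainComplex.singleFunctor C 0).obj A).X i) :=
    fun i hi => HomologicalComplex.isZero_single_obj_X _ _ _ _ hi
  -- Negative degrees vanish, degree zero is preservation of the kernel `A`, and positive degrees
  -- are the hypothesis `hex`.
  rcases lt_trichotomy n 0 with hn | rfl | hn
  · rw [quasiIsoAt_iff_exactAt]
    · exact ShortComplex.exact_of_isZero_X₂ _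
        (F.map_isZero (CochainComplex.isZero_of_isStrictlyGE _ 0 _ hn))
    · exact ShortComplex.exact_of_isZero_X₂ _ (F.map_isZero (hsrc n hn.ne))
  · have h0 := (quasiIso_iff R.ι').1 inferInstance 0
    rw [quasiIsoAt_iff' _ (-1) 0 1 (by simp) (by simp)] at h0 ⊢
    have z1 : R.cochainComplex.d (-1) 0 = 0 :=
      (CochainComplex.isZero_of_isStrictlyGE R.cochainComplex 0 _ (by lia)).eq_of_src _ _
    have z2 : ((CochainComplex.singleFunctor C 0).obj A).d (-1) 0 = 0 :=
      (hsrc (-1) (by lia)).eq_of_src _ _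
    have z3 : ((CochainComplex.singleFunctor C 0).obj A).d 0 1 = 0 :=
      (hsrc 1 (by lia)).eq_of_tgt _ _
    rw [ShortComplex.quasiIso_iff_of_zeros _ z2 z3 z1] at h0
    rw [ShortComplex.quasiIso_iff_of_zeros]
    · obtain ⟨h1, h2⟩ := h0
      exact ⟨h1.map_of_mono_of_preservesKernel F h2 inferInstance,
        @Functor.map_mono _ _ _ _ F _ _ _ _ h2⟩
    · exact (congrArg F.map z2).trans (F.map_zero _ _)
    · exact (congrArg F.map z3).trans (F.map_zero _ _)
    · exact (congrArg F.map z1).trans (F.map_zero _ _)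
  · obtain ⟨p, rfl⟩ : ∃ p : ℕ, n = p + 1 := ⟨(n - 1).toNat, by lia⟩
    rw [quasiIsoAt_iff_exactAt]
    · exact hex p
    · exact ShortComplex.exact_of_isZero_X₂ _ (F.map_isZero (hsrc _ (by lia)))

variable [HasDerivedCategory C] [HasDerivedCategory D] [EnoughInjectives C]

/-- In the naturality square of the unit along the augmentation `A → R`, the unit is invertible on
the injective complex and both images of the augmentation are invertible, so the remaining side is
too. -/
theorem isIso_rightDerivedFunctorPlusUnit_single (F : C ⥤ D) [F.Additive]
    [Limits.PreservesFiniteLimits F] {A : C} (R : InjectiveResolution A)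
    (hex : ∀ p : ℕ, ((F.mapHomologicalComplex (ComplexShape.up ℤ)).obj
      R.cochainComplex).ExactAt (p + 1 : ℤ)) :
    IsIso (F.rightDerivedFunctorPlusUnit.app
      ((HomotopyCategory.Plus.singleFunctor C 0).obj A)) := by
  let L : HomotopyCategory.Plus C :=
    (HomotopyCategory.Plus.quotient C).obj ⟨R.cochainComplex, 0, inferInstance⟩
  let α : (HomotopyCategory.Plus.singleFunctor C 0).obj A ⟶ L :=
    ObjectProperty.homMk ((HomotopyCategory.quotient C (ComplexShape.up ℤ)).map R.ι')
  have hα : HomotopyCategory.Plus.quasiIso C α := by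
    rw [HomotopyCategory.Plus.quasiIso_iff]
    exact (HomotopyCategory.quotient_map_mem_quasiIso_iff _).2
      (by rw [HomologicalComplex.mem_quasiIso_iff]; infer_instance)
  have hFα : HomotopyCategory.Plus.quasiIso D (F.mapHomotopyCategoryPlus.map α) := by
    rw [HomotopyCategory.Plus.quasiIso_iff]
    exact (HomotopyCategory.quotient_map_mem_quasiIso_iff
      ((F.mapHomologicalComplex (ComplexShape.up ℤ)).map R.ι')).2
      (by rw [HomologicalComplex.mem_quasiIso_iff]; exact quasiIso_map_resolution F R hex)
  have i1 : IsIso (DerivedCategory.Plus.Qh.map α) :=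
    Localization.inverts _ (HomotopyCategory.Plus.quasiIso C) _ hα
  have i2 : IsIso (DerivedCategory.Plus.Qh.map (F.mapHomotopyCategoryPlus.map α)) :=
    Localization.inverts _ (HomotopyCategory.Plus.quasiIso D) _ hFα
  have inj : ∀ n : ℤ, Injective (L.obj.as.X n) := fun n =>
    (inferInstance : Injective (R.cochainComplex.X n))
  have i3 : IsIso (F.rightDerivedFunctorPlusUnit.app L) := inferInstance
  have nat := F.rightDerivedFunctorPlusUnit.naturality α
  have i4 : IsIso (F.rightDerivedFunctorPlusUnit.app
      ((HomotopyCategory.Plus.singleFunctor C 0).obj A) ≫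
      (DerivedCategory.Plus.Qh ⋙ F.rightDerivedFunctorPlus).map α) := by
    rw [← nat]
    exact @IsIso.comp_isIso _ _ _ _ _ _ _ i2 i3
  have i5 : IsIso ((DerivedCategory.Plus.Qh ⋙ F.rightDerivedFunctorPlus).map α) :=
    (inferInstance : IsIso (F.rightDerivedFunctorPlus.map (DerivedCategory.Plus.Qh.map α)))
  exact IsIso.of_isIso_comp_right _
    ((DerivedCategory.Plus.Qh ⋙ F.rightDerivedFunctorPlus).map α)

end Derived

theorem isIso_toDerivedPushforward {X Y : TopCat.{0}} (f : Y ⟶ X) {F : SheafR Y}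
    (R : InjectiveResolution F)
    (hex : ∀ p : ℕ, (((TopCat.Sheaf.pushforward (ModuleCat.{0} ℝ) f).mapHomologicalComplex
      (ComplexShape.up ℤ)).obj R.cochainComplex).ExactAt (p + 1 : ℤ)) :
    IsIso (toDerivedPushforward f F) := by
  have := isIso_rightDerivedFunctorPlusUnit_single
    (TopCat.Sheaf.pushforward (ModuleCat.{0} ℝ) f) R hex
  unfold toDerivedPushforward
  refine @IsIso.comp_isIso _ _ _ _ _ _ _ ?_ this
  refine @Functor.map_isIso _ _ _ _ _ _ _ _ ?_
  refine @isIso_of_reflects_iso _ _ _ _ _ _ _ (HomotopyCategory.Plus.ι _) ?_ _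
  exact (inferInstance : IsIso ((HomotopyCategory.quotient (SheafR X) (ComplexShape.up ℤ)).map
      ((HomologicalComplex.singleMapHomologicalComplex
        (TopCat.Sheaf.pushforward (ModuleCat.{0} ℝ) f) (ComplexShape.up ℤ) 0).inv.app F)))

/-! ### Gluing primitives over a coordinate box. -/

section BoxSections

variable {Y : TopCat.{0}} {n : ℕ}

/-- Compatible local sections of an injective sheaf, over any family of open sets, are the
restrictions of a global section. -/
theorem exists_global_gluing (I : SheafR Y) [Injective I] {ι : Type} (V : ι → Opens Y)
    (t : ι → Sec I ⊤) (h : ∀ i j, res I (le_top : V i ⊓ V j ≤ ⊤) (t i) = res I le_top (t j)) :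
    ∃ u : Sec I ⊤, ∀ i, res I (le_top : V i ≤ ⊤) u = res I le_top (t i) := by
  obtain ⟨u, hu⟩ := exists_gluing I (U := iSup V) V (le_iSup V) le_rfl
    (fun i => res I le_top (t i)) (fun i j => by simpa using h i j)
  obtain ⟨u', rfl⟩ := res_surjective_of_injective I (le_top : iSup V ≤ ⊤) u
  exact ⟨u', fun i => by simpa using hu i⟩

/-- The open set of the points whose coordinates lie in a given open box. -/
def boxOpens (φ : OpenPartialHomeomorph Y (Fin n → ℝ)) (a b : Fin n → ℝ) : Opens Y :=
  ⟨φ.source ∩ φ ⁻¹' {x | ∀ i, a i < x i ∧ x i < b i}, φ.isOpen_inter_preimage (by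
    simp only [Set.ofPred_forall]
    exact isOpen_iInter_of_finite fun i => (isOpen_lt continuous_const (continuous_apply i)).inter
      (isOpen_lt (continuous_apply i) continuous_const))⟩

variable {φ : OpenPartialHomeomorph Y (Fin n → ℝ)}

theorem mem_boxOpens {a b : Fin n → ℝ} {y : Y} :
    y ∈ boxOpens φ a b ↔ y ∈ φ.source ∧ ∀ i, a i < φ y i ∧ φ y i < b i := Iff.rfl

theorem boxOpens_mono {a b a' b' : Fin n → ℝ} (ha : a' ≤ a) (hb : b ≤ b') :
    boxOpens φ a b ≤ boxOpens φ a' b' := fun _ hy =>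
  ⟨hy.1, fun i => ⟨(ha i).trans_lt (hy.2 i).1, (hy.2 i).2.trans_le (hb i)⟩⟩

theorem boxOpens_inf (a b a' b' : Fin n → ℝ) :
    boxOpens φ a b ⊓ boxOpens φ a' b' = boxOpens φ (a ⊔ a') (b ⊓ b') := by
  ext y
  change y ∈ boxOpens φ a b ∧ y ∈ boxOpens φ a' b' ↔ y ∈ boxOpens φ (a ⊔ a') (b ⊓ b')
  simp only [mem_boxOpens, Pi.sup_apply, Pi.inf_apply, sup_lt_iff, lt_inf_iff]
  constructor
  · rintro ⟨⟨h, h1⟩, -, h2⟩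
    exact ⟨h, fun i => ⟨⟨(h1 i).1, (h2 i).1⟩, (h1 i).2, (h2 i).2⟩⟩
  · rintro ⟨h, h1⟩
    exact ⟨⟨h, fun i => ⟨(h1 i).1.1, (h1 i).2.1⟩⟩, h, fun i => ⟨(h1 i).1.2, (h1 i).2.2⟩⟩

theorem isPreconnected_boxOpens {a b : Fin n → ℝ}
    (h : {x : Fin n → ℝ | ∀ i, a i < x i ∧ x i < b i} ⊆ φ.target) :
    IsPreconnected (boxOpens φ a b : Set Y) := by
  have h1 : (boxOpens φ a b : Set Y) =
      φ.symm '' {x : Fin n → ℝ | ∀ i, a i < x i ∧ x i < b i} := by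
    rw [φ.symm.image_eq_target_inter_inv_preimage h]
    rfl
  have h2 : {x : Fin n → ℝ | ∀ i, a i < x i ∧ x i < b i} =
      Set.pi Set.univ fun i => Set.Ioo (a i) (b i) := by
    ext x; simp
  rw [h1]
  refine IsPreconnected.image ?_ _ (φ.continuousOn_symm.mono h)
  rw [h2]
  exact isPreconnected_univ_pi fun i => isPreconnected_Ioo

theorem exists_boxOpens_le {y : Y} (hy : y ∈ φ.source) {V : Opens Y} (hV : y ∈ V) :
    ∃ ε > 0, boxOpens φ (fun i => φ y i - ε) (fun i => φ y i + ε) ≤ V := by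
  have h1 := (φ.continuousAt_symm (φ.map_source hy)).preimage_mem_nhds
    (t := (V : Set Y)) (by rw [φ.left_inv hy]; exact V.isOpen.mem_nhds hV)
  obtain ⟨ε, hε, hb⟩ := Metric.mem_nhds_iff.1 h1
  refine ⟨ε, hε, fun z hz => ?_⟩
  have h2 : φ z ∈ Metric.ball (φ y) ε := by
    rw [Metric.mem_ball, dist_pi_lt_iff hε]
    intro i
    rw [Real.dist_eq, abs_lt]
    have := hz.2 i
    constructor <;> linarith
  have h3 := hb h2
  rwa [Set.mem_preimage, φ.left_inv hz.1] at h3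

/-- If the cocycles of `I` over boxes extend to global cocycles, then a section of `J` over a box
which is locally in the image of `d : I ⟶ J` is in the image of `d`. -/
theorem exists_primitive_on_box {I J : SheafR Y} [Injective I] (d : I ⟶ J) {A B : Fin n → ℝ}
    (hA : {x : Fin n → ℝ | ∀ i, A i < x i ∧ x i < B i} ⊆ φ.target)
    (hext : ∀ a b, A ≤ a → b ≤ B → ∀ t : Sec I ⊤,
      res J (le_top : boxOpens φ a b ≤ ⊤) (appSec d ⊤ t) = 0 →
      ∃ z : Sec I ⊤, appSec d ⊤ z = 0 ∧ res I (le_top : boxOpens φ a b ≤ ⊤) z = res I le_top t)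
    (s : Sec J ⊤)
    (hloc : ∀ y ∈ boxOpens φ A B, ∃ (V : Opens Y) (t : Sec I ⊤), y ∈ V ∧
      res J (le_top : V ≤ ⊤) (appSec d ⊤ t) = res J le_top s) :
    ∃ t : Sec I ⊤, res J (le_top : boxOpens φ A B ≤ ⊤) (appSec d ⊤ t) = res J le_top s := by
  let P (U : Opens Y) (t : Sec I ⊤) : Prop :=
    res J (le_top : U ≤ ⊤) (appSec d ⊤ t) = res J le_top s
  have Pmono : ∀ {U V : Opens Y} {t}, V ≤ U → P U t → P V t := by
    intro U V t h hU
    have := congrArg (res J h) hU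
    simpa [P] using this
  have Plocal : ∀ {U : Opens Y} {t}, (∀ y ∈ U, ∃ V : Opens Y, y ∈ V ∧ P V t) → P U t := by
    intro U t h
    refine eq_of_locally_eq J _ _ fun y hy => ?_
    obtain ⟨V, hyV, hV⟩ := h y hy
    exact ⟨U ⊓ V, inf_le_left, ⟨hy, hyV⟩, by simpa [P] using Pmono inf_le_right hV⟩
  have Pcongr : ∀ {U : Opens Y} {t u : Sec I ⊤}, P U t →
      res I (le_top : U ≤ ⊤) u = res I le_top t → P U u := by
    intro U t u ht hu
    change res J _ _ = _
    rw [← appSec_res, hu, appSec_res]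
    exact ht
  -- two primitives over a box can be made to agree by a global cocycle
  have adjust : ∀ a b, A ≤ a → b ≤ B → ∀ t u : Sec I ⊤, P (boxOpens φ a b) t →
      P (boxOpens φ a b) u → ∃ u' : Sec I ⊤, appSec d ⊤ u' = appSec d ⊤ u ∧
        res I (le_top : boxOpens φ a b ≤ ⊤) u' = res I le_top t := by
    intro a b ha hb t u ht hu
    obtain ⟨z, hz, hzt⟩ := hext a b ha hb (t - u) (by
      rw [map_sub, map_sub, ht, hu, sub_self])
    exact ⟨u + z, by rw [map_add, hz, add_zero], by rw [map_add, hzt, map_sub]; abel⟩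
  -- Intersecting with the fixed box keeps the enlarged boxes of the induction where `hext` applies.
  let T (a b : Fin n → ℝ) : Prop := ∃ t, P (boxOpens φ a b ⊓ boxOpens φ A B) t
  have Tmono : ∀ a b a' b', a ≤ a' → b' ≤ b → T a b → T a' b' := fun a b a' b' ha hb ⟨t, ht⟩ =>
    ⟨t, Pmono (inf_le_inf_right _ (boxOpens_mono ha hb)) ht⟩
  have Tglue : ∀ a b i c d, c < d → T a (Function.update b i d) →
      T (Function.update a i c) b → T a b := by
    rintro a b i c e hce ⟨t, ht⟩ ⟨u, hu⟩
    have hW : (boxOpens φ a (Function.update b i e) ⊓ boxOpens φ A B) ⊓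
        (boxOpens φ (Function.update a i c) b ⊓ boxOpens φ A B) =
        boxOpens φ (a ⊔ A ⊔ (Function.update a i c ⊔ A))
          (Function.update b i e ⊓ B ⊓ (b ⊓ B)) := by
      simp only [boxOpens_inf]
    obtain ⟨u', hu', hut⟩ := adjust _ _ (le_sup_right.trans le_sup_left)
      (inf_le_left.trans inf_le_right) t u (Pmono (hW.ge.trans inf_le_left) ht)
      (Pmono (hW.ge.trans inf_le_right) hu)
    obtain ⟨v, hv⟩ := exists_global_gluing I (fun k : Bool => if k then
      (boxOpens φ a (Function.update b i e) ⊓ boxOpens φ A B) else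
        (boxOpens φ (Function.update a i c) b ⊓ boxOpens φ A B))
      (fun k => if k then t else u') (by
        have key : res I (le_top : (boxOpens φ a (Function.update b i e) ⊓ boxOpens φ A B) ⊓
            (boxOpens φ (Function.update a i c) b ⊓ boxOpens φ A B) ≤ ⊤) u' =
            res I le_top t := by
          have := congrArg (res I hW.le) hut
          simpa using this
        have key' : res I (le_top : (boxOpens φ (Function.update a i c) b ⊓ boxOpens φ A B) ⊓
            (boxOpens φ a (Function.update b i e) ⊓ boxOpens φ A B) ≤ ⊤) u' =
            res I le_top t := by
          have := congrArg (res I (inf_comm _ _).le) key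
          simpa using this
        rintro (_ | _) (_ | _)
        · rfl
        · exact key'
        · exact key.symm
        · rfl)
    refine ⟨v, Plocal fun y hy => ?_⟩
    -- Since `c < e`, the two subboxes cover the box.
    by_cases hyi : φ y i < e
    · refine ⟨boxOpens φ a (Function.update b i e) ⊓ boxOpens φ A B,
        ⟨⟨hy.1.1, fun k => ⟨(hy.1.2 k).1, ?_⟩⟩, hy.2⟩, Pcongr ht (hv true)⟩
      by_cases hk : k = i
      · subst hk; simpa using hyi
      · simpa [hk] using (hy.1.2 k).2
    · refine ⟨boxOpens φ (Function.update a i c) b ⊓ boxOpens φ A B,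
        ⟨⟨hy.1.1, fun k => ⟨?_, (hy.1.2 k).2⟩⟩, hy.2⟩, Pcongr (t := u') ?_ (hv false)⟩
      · by_cases hk : k = i
        · subst hk; simpa using hce.trans_le (not_lt.1 hyi)
        · simpa [hk] using (hy.1.2 k).1
      · change res J _ _ = _
        rw [hu']
        exact hu
  -- boxes which are compactly contained in the given one
  let a (m : ℕ) : Fin n → ℝ := fun i => A i + 1 / ((m : ℝ) + 1)
  let b (m : ℕ) : Fin n → ℝ := fun i => B i - 1 / ((m : ℝ) + 1)
  have hpos : ∀ m : ℕ, (0 : ℝ) < 1 / ((m : ℝ) + 1) := fun m => Nat.one_div_pos_of_nat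
  have ha : ∀ m, A ≤ a m := fun m i => le_add_of_nonneg_right (hpos m).le
  have hb : ∀ m, b m ≤ B := fun m i => sub_le_self _ (hpos m).le
  have anti : ∀ {l m : ℕ}, l ≤ m → boxOpens φ (a l) (b l) ≤ boxOpens φ (a m) (b m) := by
    intro l m hlm
    have := Nat.one_div_le_one_div (α := ℝ) hlm
    exact boxOpens_mono (fun i => add_le_add_right this _) (fun i => sub_le_sub_left this _)
  have hT : ∀ m, ∃ t, P (boxOpens φ (a m) (b m)) t := by
    intro m
    by_cases hab : a m ≤ b m
    · obtain ⟨t, ht⟩ := box_induction_compact Tmono Tglue hab (fun x hx => by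
        have hxAB : ∀ i, A i < x i ∧ x i < B i := fun i =>
          ⟨(lt_add_of_pos_right _ (hpos m)).trans_le (hx.1 i),
            (hx.2 i).trans_lt (sub_lt_self _ (hpos m))⟩
        have hxt : x ∈ φ.target := hA hxAB
        have hy : φ.symm x ∈ φ.source := φ.map_target hxt
        obtain ⟨V, t, hyV, ht⟩ := hloc (φ.symm x) ⟨hy, by
          change ∀ i, A i < φ (φ.symm x) i ∧ φ (φ.symm x) i < B i
          rw [φ.right_inv hxt]; exact hxAB⟩
        obtain ⟨ε, hε, hbox⟩ := exists_boxOpens_le hy hyV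
        rw [φ.right_inv hxt] at hbox
        exact ⟨ε, hε, t, Pmono (inf_le_left.trans hbox) ht⟩)
      exact ⟨t, Pmono (le_inf le_rfl (boxOpens_mono (ha m) (hb m))) ht⟩
    · refine ⟨0, Plocal fun y hy => (hab fun i => ?_).elim⟩
      exact ((hy.2 i).1.trans (hy.2 i).2).le
  -- A primitive on the next box is corrected by a global cocycle so that it agrees with the
  -- previous one. The resulting sequence is compatible and glues over the exhaustion.
  have step : ∀ m (t : {t // P (boxOpens φ (a m) (b m)) t}),
      ∃ u : {t // P (boxOpens φ (a (m + 1)) (b (m + 1))) t},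
      res I (le_top : boxOpens φ (a m) (b m) ≤ ⊤) u.1 = res I le_top t.1 := by
    rintro m ⟨t, ht⟩
    obtain ⟨u, hu⟩ := hT (m + 1)
    obtain ⟨u', hu', h⟩ := adjust _ _ (ha m) (hb m) t u ht (Pmono (anti m.le_succ) hu)
    refine ⟨⟨u', ?_⟩, h⟩
    change res J _ _ = _
    rw [hu']; exact hu
  choose next hnext using step
  let u (m : ℕ) : {t // P (boxOpens φ (a m) (b m)) t} :=
    Nat.rec ⟨(hT 0).choose, (hT 0).choose_spec⟩ (fun m t => next m t) m
  have hu : ∀ l m, l ≤ m → res I (le_top : boxOpens φ (a l) (b l) ≤ ⊤) (u m).1 =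
      res I le_top (u l).1 := by
    intro l m hlm
    induction m, hlm using Nat.le_induction with
    | base => rfl
    | succ m hlm ih =>
      rw [← ih]
      have := congrArg (res I (anti hlm)) (hnext m (u m))
      simpa using this
  obtain ⟨v, hv⟩ := exists_global_gluing I (fun m => boxOpens φ (a m) (b m)) (fun m => (u m).1) (by
    intro l m
    rcases le_total l m with h | h
    · have := congrArg (res I (inf_le_left : boxOpens φ (a l) (b l) ⊓ boxOpens φ (a m) (b m) ≤ _))
        (hu l m h)
      simpa using this.symm
    · have := congrArg (res I (inf_le_right : boxOpens φ (a l) (b l) ⊓ boxOpens φ (a m) (b m) ≤ _))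
        (hu m l h)
      simpa using this)
  refine ⟨v, Plocal fun y hy => ?_⟩
  have hev : ∀ᶠ m : ℕ in atTop, ∀ i, a m i < φ y i ∧ φ y i < b m i := by
    rw [Filter.eventually_all]
    intro i
    have h0 := tendsto_one_div_add_atTop_nhds_zero_nat (𝕜 := ℝ)
    filter_upwards [h0.eventually_lt_const (sub_pos.2 (hy.2 i).1),
      h0.eventually_lt_const (sub_pos.2 (hy.2 i).2)] with m h1 h2
    exact ⟨lt_sub_iff_add_lt'.1 h1, lt_sub_comm.1 h2⟩
  obtain ⟨m, hm⟩ := hev.exists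
  exact ⟨boxOpens φ (a m) (b m), ⟨hy.1, hm⟩, Pcongr (u m).2 (hv m)⟩

end BoxSections

/-! ### Acyclicity of boxes and exactness of the pushed-forward resolution. -/

section Acyclic

variable {Y : TopCat.{0}} {n : ℕ}

/-- The cocycles of `K` in degree `p` over boxes in the target of `φ` extend to global ones. -/
def CocyclesExtend (K : CochainComplex (SheafR Y) ℤ) (φ : OpenPartialHomeomorph Y (Fin n → ℝ))
    (p : ℕ) : Prop :=
  ∀ (a b : Fin n → ℝ), {x : Fin n → ℝ | ∀ i, a i < x i ∧ x i < b i} ⊆ φ.target →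
    ∀ t : Sec (K.X p) ⊤,
      res (K.X (p + 1 : ℤ)) (le_top : boxOpens φ a b ≤ ⊤) (appSec (K.d p (p + 1)) ⊤ t) = 0 →
      ∃ z : Sec (K.X p) ⊤, appSec (K.d p (p + 1)) ⊤ z = 0 ∧
        res (K.X p) (le_top : boxOpens φ a b ≤ ⊤) z = res (K.X p) le_top t

/-- Exactness of `K` gives primitives near each point, flasqueness makes them global, and
`exists_primitive_on_box` assembles them. -/
theorem CocyclesExtend.exists_primitive {K : CochainComplex (SheafR Y) ℤ}
    [∀ i, Injective (K.X i)] {φ : OpenPartialHomeomorph Y (Fin n → ℝ)} {p : ℕ}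
    (hext : CocyclesExtend K φ p) (hK : K.ExactAt (p + 1 : ℤ)) {a b : Fin n → ℝ}
    (hab : {x : Fin n → ℝ | ∀ i, a i < x i ∧ x i < b i} ⊆ φ.target)
    (t : Sec (K.X (p + 1 : ℤ)) ⊤)
    (ht : res (K.X (p + 1 + 1 : ℤ)) (le_top : boxOpens φ a b ≤ ⊤)
        (appSec (K.d (p + 1) (p + 1 + 1)) ⊤ t) = 0) :
    ∃ u : Sec (K.X p) ⊤, res (K.X (p + 1 : ℤ)) (le_top : boxOpens φ a b ≤ ⊤)
        (appSec (K.d p (p + 1)) ⊤ u) = res (K.X (p + 1 : ℤ)) le_top t := by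
  have hloc := (exact_iff_locally_exact _).1
    ((K.exactAt_iff' (p : ℤ) (p + 1) (p + 1 + 1) (by simp) (by simp)).1 hK)
  refine exists_primitive_on_box (φ := φ) (K.d (p : ℤ) (p + 1)) hab
    (fun a' b' ha hb => hext a' b' fun x hx => hab fun i =>
      ⟨(ha i).trans_lt (hx i).1, (hx i).2.trans_le (hb i)⟩) t (fun y hy => ?_)
  obtain ⟨V, hV, v, hyV, hv⟩ := hloc (boxOpens φ a b) (res (K.X (p + 1 : ℤ)) le_top t)
    ((appSec_res _ _ _).trans ht) y hy
  obtain ⟨v', rfl⟩ := res_surjective_of_injective (K.X p) (le_top : V ≤ ⊤) v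
  refine ⟨V, v', hyV, ?_⟩
  have h1 : appSec (K.d (p : ℤ) (p + 1)) V (res (K.X p) le_top v') =
    res (K.X (p + 1 : ℤ)) hV (res (K.X (p + 1 : ℤ)) le_top t) := hv
  rw [← appSec_res, h1, res_res]

/-- The cocycles of an injective resolution of the constant sheaf over boxes extend to global
cocycles. -/
theorem cocyclesExtend (K : CochainComplex (SheafR Y) ℤ) [∀ i, Injective (K.X i)]
    (ε : constSheaf Y ⟶ K.X 0) (w : ε ≫ K.d 0 1 = 0) (hε : (ShortComplex.mk ε (K.d 0 1) w).Exact)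
    [Mono ε] (hK : ∀ p : ℕ, K.ExactAt (p + 1 : ℤ)) (φ : OpenPartialHomeomorph Y (Fin n → ℝ))
    (p : ℕ) : CocyclesExtend K φ p := by
  induction p with
  | zero =>
    intro a b hab t ht
    -- A cocycle of degree zero is a section of the constant sheaf, hence a constant on the
    -- connected box.
    rw [← appSec_res] at ht
    obtain ⟨f, hf⟩ := exists_section_of_exact_of_mono (S := ShortComplex.mk ε (K.d 0 1) w) hε
      (res (K.X (0 : ℤ)) le_top t) ht
    obtain ⟨r, rfl⟩ := exists_eq_constSection (isPreconnected_boxOpens hab) f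
    refine ⟨appSec ε ⊤ (constSection ⊤ r), ?_, Eq.trans ?_ hf⟩
    · change appSec (K.d 0 1) ⊤ _ = 0
      rw [← appSec_comp, w, appSec_zero]
    · change res (K.X 0) _ _ = _
      rw [← appSec_res, res_constSection]
  | succ p ih =>
    intro a b hab t ht
    obtain ⟨u, hu⟩ := ih.exists_primitive (hK p) hab t ht
    -- The primitive `u` on the box is itself a global section, so its differential is a cocycle
    -- everywhere.
    refine ⟨appSec (K.d (p : ℤ) (p + 1)) ⊤ u, ?_, hu⟩
    change appSec (K.d (p + 1 : ℤ) (p + 1 + 1)) ⊤ _ = 0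
    rw [← appSec_comp, K.d_comp_d, appSec_zero]

/-- If the intersections of small open subsets of `X` with `Y` are finite disjoint unions of boxes,
the direct image of an injective resolution of the constant sheaf is exact in positive degrees. -/
theorem exactAt_pushforward {X : TopCat.{0}} (j : Y ⟶ X) {κ : Type} [Finite κ]
    (φ : κ → OpenPartialHomeomorph Y (Fin n → ℝ)) (hcov : ∀ y, ∃ k, y ∈ (φ k).source)
    (hdisj : ∀ k l y, y ∈ (φ k).source → y ∈ (φ l).source → k = l)
    (hbox : ∀ (k : κ) (U : Opens X), ∀ x ∈ U, ∃ V : Opens X, x ∈ V ∧ ∃ a b : Fin n → ℝ,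
      {x : Fin n → ℝ | ∀ i, a i < x i ∧ x i < b i} ⊆ (φ k).target ∧
      (∀ y ∈ (φ k).source, j y ∈ V → y ∈ boxOpens (φ k) a b) ∧
      boxOpens (φ k) a b ≤ (Opens.map j).obj U)
    (K : CochainComplex (SheafR Y) ℤ) [∀ i, Injective (K.X i)]
    (ε : constSheaf Y ⟶ K.X 0) (w : ε ≫ K.d 0 1 = 0) (hε : (ShortComplex.mk ε (K.d 0 1) w).Exact)
    [Mono ε] (hK : ∀ p : ℕ, K.ExactAt (p + 1 : ℤ)) (p : ℕ) :
    (((TopCat.Sheaf.pushforward (ModuleCat.{0} ℝ) j).mapHomologicalComplex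
      (ComplexShape.up ℤ)).obj K).ExactAt (p + 1 : ℤ) := by
  rw [HomologicalComplex.exactAt_iff' _ (p : ℤ) (p + 1) (p + 1 + 1) (by simp) (by simp),
    exact_iff_locally_exact]
  intro U s hs x hx
  change Sec (K.X (p + 1 : ℤ)) ((Opens.map j).obj U) at s
  replace hs : appSec (K.d (p + 1 : ℤ) (p + 1 + 1)) ((Opens.map j).obj U) s = 0 := hs
  suffices h : ∃ (V : Opens X) (hV : V ≤ U) (t : Sec (K.X p) ((Opens.map j).obj V)), x ∈ V ∧
      appSec (K.d (p : ℤ) (p + 1)) ((Opens.map j).obj V) t =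
        res (K.X (p + 1 : ℤ)) ((Opens.map j).monotone hV) s from h
  choose V hxV a b hab hVbox hboxU using fun k => hbox k U x hx
  obtain ⟨s', rfl⟩ := res_surjective_of_injective (K.X (p + 1 : ℤ))
    (le_top : (Opens.map j).obj U ≤ ⊤) s
  have hs' : ∀ k, res (K.X (p + 1 + 1 : ℤ)) (le_top : boxOpens (φ k) (a k) (b k) ≤ ⊤)
      (appSec (K.d (p + 1) (p + 1 + 1)) ⊤ s') = 0 := by
    intro k
    rw [appSec_res] at hs
    have := congrArg (res (K.X (p + 1 + 1 : ℤ)) (hboxU k)) hs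
    simpa using this
  choose t ht using fun k =>
    (cocyclesExtend K ε w hε hK (φ k) p).exists_primitive (hK p) (hab k) s' (hs' k)
  -- Finiteness of `κ` gives one neighbourhood for all charts. Its preimage is the disjoint union of
  -- the `W k`, so the primitives on the boxes glue without any correction.
  let V' : Opens X := U ⊓ ⟨⋂ k, V k, isOpen_iInter_of_finite fun k => (V k).isOpen⟩
  let W (k : κ) : Opens Y := ⟨(φ k).source, (φ k).open_source⟩ ⊓ (Opens.map j).obj V'
  have hW : ∀ k, W k ≤ boxOpens (φ k) (a k) (b k) := fun k y hy =>
    hVbox k y hy.1 (Set.mem_iInter.1 hy.2.2 k)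
  obtain ⟨u, hu⟩ := exists_gluing (K.X p) (U := (Opens.map j).obj V') W (fun k => inf_le_right)
    (fun y hy => by
      obtain ⟨k, hk⟩ := hcov y
      exact Opens.mem_iSup.2 ⟨k, hk, hy⟩)
    (fun k => res (K.X p) le_top (t k)) (fun k l => by
      refine eq_of_locally_eq _ _ _ fun y hy => ?_
      obtain rfl := hdisj k l y hy.1.1 hy.2.1
      exact ⟨W k ⊓ W k, le_rfl, hy, rfl⟩)
  refine ⟨V', inf_le_left, u, ⟨hx, Set.mem_iInter.2 hxV⟩, ?_⟩
  refine eq_of_locally_eq _ _ _ fun y hy => ?_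
  obtain ⟨k, hk⟩ := hcov y
  refine ⟨W k, inf_le_right, ⟨hk, hy⟩, ?_⟩
  rw [← appSec_res, hu, appSec_res, res_res, res_res]
  have := congrArg (res (K.X (p + 1 : ℤ)) (hW k)) (ht k)
  simpa using this

end Acyclic

/-! ### The comparison morphism under abstract hypotheses. -/

section Comparison

variable {C : Type*} [Category* C] [Abelian C] {A : C}

/-- The augmentation of an injective resolution. -/
def resolutionUnit (R : InjectiveResolution A) : A ⟶ R.cocomplex.X 0 := R.ι.f 0

/-- The augmentation of an injective resolution, as a morphism to the term of degree zero of the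
corresponding complex indexed by the integers. -/
noncomputable def resolutionAugmentation (R : InjectiveResolution A) :
    A ⟶ R.cochainComplex.X 0 :=
  resolutionUnit R ≫ (R.cochainComplexXIso 0 0 rfl).inv

theorem resolutionUnit_comp_d (R : InjectiveResolution A) :
    resolutionUnit R ≫ R.cocomplex.d 0 1 = 0 := R.ι_f_zero_comp_complex_d

theorem resolutionUnit_exact (R : InjectiveResolution A) :
    (ShortComplex.mk _ _ (resolutionUnit_comp_d R)).Exact :=
  ShortComplex.exact_of_f_is_kernel
    (ShortComplex.mk (resolutionUnit R) (R.cocomplex.d 0 1) _) R.isLimitKernelFork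

instance (R : InjectiveResolution A) : Mono (resolutionUnit R) :=
  (inferInstance : Mono (R.ι.f 0))

theorem resolutionAugmentation_comp_d (R : InjectiveResolution A) :
    resolutionAugmentation R ≫ R.cochainComplex.d 0 1 = 0 := by
  rw [resolutionAugmentation, R.cochainComplex_d 0 1 0 1 rfl rfl, Category.assoc,
    Iso.inv_hom_id_assoc, ← Category.assoc, resolutionUnit_comp_d, Limits.zero_comp]

instance (R : InjectiveResolution A) : Mono (resolutionAugmentation R) := mono_comp _ _

theorem resolutionAugmentation_exact (R : InjectiveResolution A) :
    (ShortComplex.mk _ _ (resolutionAugmentation_comp_d R)).Exact := by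
  let e : ShortComplex.mk _ _ (resolutionUnit_comp_d R) ≅
      ShortComplex.mk _ _ (resolutionAugmentation_comp_d R) :=
    ShortComplex.isoMk (Iso.refl A) (R.cochainComplexXIso 0 0 rfl).symm
      (R.cochainComplexXIso 1 1 rfl).symm (Category.id_comp _) (by
        change (R.cochainComplexXIso 0 0 rfl).inv ≫ R.cochainComplex.d 0 1 =
          R.cocomplex.d 0 1 ≫ (R.cochainComplexXIso 1 1 rfl).inv
        rw [R.cochainComplex_d 0 1 0 1 rfl rfl, Iso.inv_hom_id_assoc])
  exact (ShortComplex.exact_iff_of_iso e).1 (resolutionUnit_exact R)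

theorem exactAt_cochainComplex (R : InjectiveResolution A) (p : ℕ) : R.cochainComplex.ExactAt (p + 1 : ℤ) := by
  rw [← quasiIsoAt_iff_exactAt R.ι' (p + 1 : ℤ)
    (ShortComplex.exact_of_isZero_X₂ _ (HomologicalComplex.isZero_single_obj_X
      (ComplexShape.up ℤ) 0 A _ (by lia)))]
  infer_instance

/-- Each factor is invertible: `ι_! → ι_*` by properness, `ℝ → i_* ℝ` by local asphericity, `j_* → R
j_*` by acyclicity of boxes. -/
theorem isIso_comparison {U Y X : TopCat.{0}} (i : U ⟶ Y) (ι : Y ⟶ X) (j : U ⟶ X)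
    (h : i ≫ ι = j) (hi : LocallyAspheric i) (hι : IsProperMap ι) {n : ℕ} {κ : Type} [Finite κ]
    (φ : κ → OpenPartialHomeomorph U (Fin n → ℝ)) (hcov : ∀ y, ∃ k, y ∈ (φ k).source)
    (hdisj : ∀ k l y, y ∈ (φ k).source → y ∈ (φ l).source → k = l)
    (hbox : ∀ (k : κ) (V : Opens X), ∀ x ∈ V, ∃ V' : Opens X, x ∈ V' ∧ ∃ a b : Fin n → ℝ,
      {x : Fin n → ℝ | ∀ i, a i < x i ∧ x i < b i} ⊆ (φ k).target ∧
      (∀ y ∈ (φ k).source, j y ∈ V' → y ∈ boxOpens (φ k) a b) ∧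
      boxOpens (φ k) a b ≤ (Opens.map j).obj V) :
    IsIso (comparison i ι j h) := by
  let R : InjectiveResolution (constSheaf U) := injectiveResolution (constSheaf U)
  have h1 : IsIso (toDerivedPushforward j (constSheaf U)) :=
    isIso_toDerivedPushforward j R fun p =>
      exactAt_pushforward j φ hcov hdisj hbox R.cochainComplex (resolutionAugmentation R)
        (resolutionAugmentation_comp_d R) (resolutionAugmentation_exact R) (exactAt_cochainComplex R) p
  have h2 := isIso_constSheafRes i hi
  have h3 := isIso_properPushforwardι ι hι (constSheaf Y)
  unfold comparison
  infer_instance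

end Comparison

/-! ### Disjoint unions of open orthants and their closures. -/

section Orthants

/-- The open orthant. -/
def openOrthant (n : ℕ) : Set (Fin n → ℝ) := {x | ∀ i, 0 < x i}

/-- The closed orthant. -/
def closedOrthant (n : ℕ) : Set (Fin n → ℝ) := {x | ∀ i, 0 ≤ x i}

theorem openOrthant_eq_pi (n : ℕ) : openOrthant n = Set.univ.pi fun _ => Set.Ioi 0 := by
  ext x; simp [openOrthant]

theorem isOpen_openOrthant (n : ℕ) : IsOpen (openOrthant n) := by
  rw [openOrthant_eq_pi]
  exact isOpen_set_pi Set.finite_univ fun _ _ => isOpen_Ioi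

theorem convex_openOrthant (n : ℕ) : Convex ℝ (openOrthant n) := by
  rw [openOrthant_eq_pi]
  exact convex_pi fun _ _ => convex_Ioi 0

theorem convex_closedOrthant (n : ℕ) : Convex ℝ (closedOrthant n) := by
  have : closedOrthant n = Set.univ.pi fun _ => Set.Ici 0 := by
    ext x; simp [closedOrthant, Pi.le_def]
  rw [this]
  exact convex_pi fun _ _ => convex_Ici 0

theorem closure_openOrthant (n : ℕ) : closure (openOrthant n) = closedOrthant n := by
  rw [openOrthant_eq_pi, closure_pi_set]
  ext x; simp [closedOrthant, Pi.le_def]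

variable {Z : Type} [TopologicalSpace Z] {n : ℕ} {κ : Type}

/-- A subset `W` is a disjoint union of open orthants for the charts `h k` if each of its points
lies in the open orthant of exactly one chart. -/
structure IsOrthantUnion (W : Set Z) (h : κ → Z ≃ₜ (Fin n → ℝ)) : Prop where
  mem_iff : ∀ z, z ∈ W ↔ ∃ k, h k z ∈ openOrthant n
  unique : ∀ k l z, h k z ∈ openOrthant n → h l z ∈ openOrthant n → k = l

variable {W : Set Z} {h : κ → Z ≃ₜ (Fin n → ℝ)}

/-- The part of `W` in the open orthant of the chart `h k`. -/
def orthantPart (W : Set Z) (h : κ → Z ≃ₜ (Fin n → ℝ)) (k : κ) : Set W :=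
  {w | h k w ∈ openOrthant n}

theorem isOpen_orthantPart (k : κ) : IsOpen (orthantPart W h k) :=
  (isOpen_openOrthant n).preimage ((h k).continuous.comp continuous_subtype_val)

theorem toDagger_eq {w : W} {c : ConnectedComponents W}
    {p : closure (Subtype.val '' (ConnectedComponents.mk ⁻¹' {c} : Set W))}
    (hc : ConnectedComponents.mk w = c) (hp : w.1 = p.1) : toDagger W w = ⟨c, p⟩ := by
  subst hc
  exact congrArg (Sigma.mk _) (Subtype.ext hp)

namespace IsOrthantUnion

variable (H : IsOrthantUnion W h)
include H

theorem isOpen : IsOpen W := by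
  have : W = ⋃ k, h k ⁻¹' openOrthant n := by
    ext z; simp [H.mem_iff]
  rw [this]
  exact isOpen_iUnion fun k => (isOpen_openOrthant n).preimage (h k).continuous

theorem exists_mem (w : W) : ∃ k, w ∈ orthantPart W h k := (H.mem_iff w).1 w.2

theorem image_orthantPart (k : κ) :
    Subtype.val '' orthantPart W h k = h k ⁻¹' openOrthant n := by
  ext z
  constructor
  · rintro ⟨w, hw, rfl⟩; exact hw
  · intro hz; exact ⟨⟨z, (H.mem_iff z).2 ⟨k, hz⟩⟩, hz, rfl⟩

theorem closure_image_orthantPart (k : κ) :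
    closure (Subtype.val '' orthantPart W h k) = h k ⁻¹' closedOrthant n := by
  rw [H.image_orthantPart, ← (h k).preimage_closure, closure_openOrthant]

theorem isClosed_orthantPart (k : κ) : IsClosed (orthantPart W h k) := by
  rw [← isOpen_compl_iff]
  have : (orthantPart W h k)ᶜ = ⋃ l, ⋃ _ : l ≠ k, orthantPart W h l := by
    ext w
    simp only [Set.mem_compl_iff, Set.mem_iUnion]
    constructor
    · intro hw
      obtain ⟨l, hl⟩ := H.exists_mem w
      exact ⟨l, fun hlk => hw (hlk ▸ hl), hl⟩
    · rintro ⟨l, hlk, hl⟩ hk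
      exact hlk (H.unique l k w hl hk)
  rw [this]
  exact isOpen_iUnion fun l => isOpen_iUnion fun _ => isOpen_orthantPart l

theorem isPreconnected_orthantPart (k : κ) : IsPreconnected (orthantPart W h k) := by
  rw [← IsInducing.subtypeVal.isPreconnected_image, H.image_orthantPart, ← (h k).image_symm]
  exact (convex_openOrthant n).isPreconnected.image _ (h k).symm.continuous.continuousOn

/-- An orthant part is clopen and connected, hence a component. -/
theorem preimage_mk {k : κ} {w : W} (hw : w ∈ orthantPart W h k) :
    (ConnectedComponents.mk ⁻¹' {(ConnectedComponents.mk w)} : Set W) = orthantPart W h k := by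
  rw [connectedComponents_preimage_singleton]
  exact (IsClopen.connectedComponent_subset
    ⟨H.isClosed_orthantPart k, isOpen_orthantPart k⟩ hw).antisymm
    ((H.isPreconnected_orthantPart k).subset_connectedComponent hw)

theorem exists_preimage_mk (c : ConnectedComponents W) :
    ∃ k, (ConnectedComponents.mk ⁻¹' {c} : Set W) = orthantPart W h k := by
  obtain ⟨w, rfl⟩ := ConnectedComponents.surjective_coe c
  obtain ⟨k, hk⟩ := H.exists_mem w
  exact ⟨k, H.preimage_mk hk⟩

theorem finite_connectedComponents [Finite κ] : Finite (ConnectedComponents W) := by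
  choose k hk using H.exists_preimage_mk
  refine Finite.of_injective k fun c c' hcc => ?_
  obtain ⟨w, rfl⟩ := ConnectedComponents.surjective_coe c
  have : w ∈ (ConnectedComponents.mk ⁻¹' {c'} : Set W) := by
    rw [hk, ← hcc, ← hk]; rfl
  exact this

/-- There are finitely many summands, each closed in `Z`; thus the map is closed and its fibres are
finite. -/
theorem isProperMap_daggerMap [Finite κ] : IsProperMap (daggerMap W) := by
  have := H.finite_connectedComponents
  rw [isProperMap_iff_isClosedMap_and_compact_fibers]
  refine ⟨(daggerMap W).hom.continuous, fun S hS => ?_, fun z => Set.Finite.isCompact ?_⟩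
  · change Set (Dagger W) at S
    have : daggerMap W '' S = ⋃ c : ConnectedComponents W,
        Subtype.val '' ((fun p => (⟨c, p⟩ : Dagger W)) ⁻¹' S) := by
      ext z
      simp only [Set.mem_iUnion]
      constructor
      · rintro ⟨⟨c, p⟩, hp, rfl⟩; exact ⟨c, p, hp, rfl⟩
      · rintro ⟨c, p, hp, rfl⟩; exact ⟨⟨c, p⟩, hp, rfl⟩
    rw [this]
    exact isClosed_iUnion_of_finite fun c =>
      isClosed_closure.isClosedEmbedding_subtypeVal.isClosedMap _ (isClosed_sigma_iff.1 hS c)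
  · refine Set.Finite.of_finite_image (f := Sigma.fst) (Set.toFinite _) ?_
    rintro ⟨c, p⟩ hp ⟨c', p'⟩ hp' hcc
    obtain rfl : c = c' := hcc
    have : p.1 = p'.1 := hp.trans hp'.symm
    rw [Subtype.ext this]

/-- The point is that the components of `W` are open, since orthant parts are. -/
theorem continuous_toDagger : Continuous (toDagger W) := by
  refine continuous_def.2 fun S hS => ?_
  choose O hO hOS using fun c => isOpen_induced_iff.1 (isOpen_sigma_iff.1 hS c)
  have : toDagger W ⁻¹' S =
      ⋃ c, (ConnectedComponents.mk ⁻¹' {c} : Set W) ∩ Subtype.val ⁻¹' O c := by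
    ext w
    have key : toDagger W w ∈ S ↔ w.1 ∈ O (ConnectedComponents.mk w) := by
      have := Set.ext_iff.1 (hOS (ConnectedComponents.mk w)) (toDagger W w).2
      exact this.symm
    simp [key]
  rw [this]
  refine isOpen_iUnion fun c => IsOpen.inter ?_ ((hO c).preimage continuous_subtype_val)
  obtain ⟨k, hk⟩ := H.exists_preimage_mk c
  rw [hk]
  exact isOpen_orthantPart k

theorem isOpenEmbedding_toDagger : IsOpenEmbedding (toDagger W) where
  toIsEmbedding := IsEmbedding.of_comp H.continuous_toDagger (daggerMap W).hom.continuous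
    IsEmbedding.subtypeVal
  isOpen_range := by
    refine isOpen_sigma_iff.2 fun c => ?_
    obtain ⟨k, hk⟩ := H.exists_preimage_mk c
    have : Sigma.mk c ⁻¹' Set.range (toDagger W) = Subtype.val ⁻¹' (h k ⁻¹' openOrthant n) := by
      ext p
      rw [← H.image_orthantPart, ← hk]
      constructor
      · rintro ⟨w, hw⟩
        obtain ⟨rfl, hp⟩ := Sigma.mk.inj_iff.1 hw
        exact ⟨w, rfl, congrArg Subtype.val (eq_of_heq hp)⟩
      · rintro ⟨w, hc, hw⟩
        exact ⟨w, toDagger_eq hc hw⟩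
    rw [this]
    exact ((isOpen_openOrthant n).preimage (h k).continuous).preimage continuous_subtype_val

/-- A chart ball about a point of the closed orthant meets the closed and the open orthant in convex
sets; the second is nonempty because the open orthant is dense in the closed one. -/
theorem locallyAspheric_toDagger : LocallyAspheric (toDagger W) := by
  rintro ⟨c, z⟩ N hN
  obtain ⟨k, hk⟩ := H.exists_preimage_mk c
  have hcl : ∀ z', z' ∈ closure (Subtype.val '' (ConnectedComponents.mk ⁻¹' {c} : Set W)) ↔
      h k z' ∈ closedOrthant n := fun z' => by
    rw [hk, H.closure_image_orthantPart, Set.mem_preimage]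
  have hN' : Sigma.mk c ⁻¹' N ∈ 𝓝 z := continuous_sigmaMk.continuousAt.preimage_mem_nhds hN
  obtain ⟨O, hO, hON⟩ := mem_nhds_subtype _ _ _ |>.1 hN'
  have hO' : (h k).symm ⁻¹' O ∈ 𝓝 (h k z.1) :=
    (h k).symm.continuous.continuousAt.preimage_mem_nhds (by rwa [(h k).symm_apply_apply])
  obtain ⟨ε, hε, hball⟩ := Metric.mem_nhds_iff.1 hO'
  let V : Set (Dagger W) := Sigma.mk c '' (Subtype.val ⁻¹' (h k ⁻¹' Metric.ball (h k z.1) ε))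
  have hz : h k z.1 ∈ closedOrthant n := (hcl z.1).1 z.2
  refine ⟨V, isOpenMap_sigmaMk _ ((Metric.isOpen_ball.preimage (h k).continuous).preimage
    continuous_subtype_val), ⟨z, Metric.mem_ball_self hε, rfl⟩, ?_, ?_, ?_⟩
  · rintro _ ⟨p, hp, rfl⟩
    refine hON (?_ : p.1 ∈ O)
    have := hball hp
    rwa [Set.mem_preimage, (h k).symm_apply_apply] at this
  · let g (x : (closedOrthant n ∩ Metric.ball (h k z.1) ε : Set (Fin n → ℝ))) : Dagger W :=
      ⟨c, (h k).symm x.1, (hcl _).2 (by rw [(h k).apply_symm_apply]; exact x.2.1)⟩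
    have hg : IsEmbedding g := IsEmbedding.sigmaMk.comp
      (((h k).symm.isEmbedding.comp IsEmbedding.subtypeVal).codRestrict _ _)
    have hV : V = Set.range g := by
      ext p
      constructor
      · rintro ⟨q, hq, rfl⟩
        refine ⟨⟨h k q.1, (hcl _).1 q.2, hq⟩, ?_⟩
        exact Sigma.ext rfl (heq_of_eq (Subtype.ext ((h k).symm_apply_apply _)))
      · rintro ⟨x, rfl⟩
        refine ⟨(g x).2, ?_, rfl⟩
        change h k ((h k).symm x.1) ∈ Metric.ball (h k z.1) ε
        rw [(h k).apply_symm_apply]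
        exact x.2.2
    have hc : ContractibleSpace
        (closedOrthant n ∩ Metric.ball (h k z.1) ε : Set (Fin n → ℝ)) :=
      ((convex_closedOrthant n).inter (convex_ball _ _)).contractibleSpace
        ⟨h k z.1, hz, Metric.mem_ball_self hε⟩
    rw [hV]
    exact hg.toHomeomorph.symm.contractibleSpace
  · let g (x : (openOrthant n ∩ Metric.ball (h k z.1) ε : Set (Fin n → ℝ))) : W :=
      ⟨(h k).symm x.1, (H.mem_iff _).2 ⟨k, by rw [(h k).apply_symm_apply]; exact x.2.1⟩⟩
    have hg : IsEmbedding g :=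
      ((h k).symm.isEmbedding.comp IsEmbedding.subtypeVal).codRestrict _ _
    have hV : toDagger W ⁻¹' V = Set.range g := by
      ext w
      constructor
      · rintro ⟨q, hq, hqw⟩
        obtain ⟨hc, hqw⟩ := Sigma.mk.inj_iff.1 hqw
        subst hc
        obtain rfl := eq_of_heq hqw
        have hw : w ∈ (ConnectedComponents.mk ⁻¹' {(ConnectedComponents.mk w)} : Set W) := rfl
        rw [hk] at hw
        exact ⟨⟨h k w.1, hw, hq⟩, Subtype.ext ((h k).symm_apply_apply _)⟩
      · rintro ⟨x, rfl⟩
        have hw : g x ∈ (ConnectedComponents.mk ⁻¹' {c} : Set W) := by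
          rw [hk]
          change h k ((h k).symm x.1) ∈ openOrthant n
          rw [(h k).apply_symm_apply]
          exact x.2.1
        refine ⟨⟨g x, subset_closure ⟨g x, hw, rfl⟩⟩, ?_, (toDagger_eq hw rfl).symm⟩
        change h k ((h k).symm x.1) ∈ Metric.ball (h k z.1) ε
        rw [(h k).apply_symm_apply]
        exact x.2.2
    have hc : ContractibleSpace
        (openOrthant n ∩ Metric.ball (h k z.1) ε : Set (Fin n → ℝ)) := by
      refine ((convex_openOrthant n).inter (convex_ball _ _)).contractibleSpace ?_
      rw [← closure_openOrthant, Metric.mem_closure_iff] at hz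
      obtain ⟨x, hx, hxz⟩ := hz ε hε
      exact ⟨x, hx, Metric.mem_ball'.2 hxz⟩
    rw [hV]
    exact hg.toHomeomorph.symm.contractibleSpace

omit H in
/-- The chart of `W` on the open orthant of `h k`. -/
noncomputable def chart (H : IsOrthantUnion W h) (k : κ) :
    OpenPartialHomeomorph W (Fin n → ℝ) :=
  ((Opens.openPartialHomeomorphSubtypeCoe ⟨W, H.isOpen⟩
    -- The point with all coordinates `1` shows that `W` is nonempty, as the inclusion chart
    -- requires.
    ⟨(h k).symm 1, (H.mem_iff _).2 ⟨k, fun i => by simp⟩⟩).trans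
    (h k).toOpenPartialHomeomorph).restrOpen (orthantPart W h k) (isOpen_orthantPart k)

theorem chart_source (k : κ) : (H.chart k).source = orthantPart W h k := by
  simp [chart]

theorem chart_apply (k : κ) (w : W) : H.chart k w = h k w := rfl

theorem openOrthant_subset_chart_target (k : κ) : openOrthant n ⊆ (H.chart k).target := by
  intro x hx
  have hx' : h k ((h k).symm x) ∈ openOrthant n := by rwa [(h k).apply_symm_apply]
  have := (H.chart k).map_source (x := ⟨(h k).symm x, (H.mem_iff _).2 ⟨k, hx'⟩⟩)
    (by rw [H.chart_source]; exact hx')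
  rwa [H.chart_apply, (h k).apply_symm_apply] at this

theorem isIso_comparison [Finite κ] (i : TopCat.of W ⟶ TopCat.of (Dagger W))
    (hi : ∀ w, i w = toDagger W w) (hij : i ≫ daggerMap W = inclusionMap W) :
    IsIso (comparison i (daggerMap W) (inclusionMap W) hij) := by
  have hi' : (i : W → Dagger W) = toDagger W := funext hi
  refine TropicalComplement.isIso_comparison i (daggerMap W) (inclusionMap W) hij
    (by rw [hi']; exact H.locallyAspheric_toDagger) H.isProperMap_daggerMap
    (U := TopCat.of W) H.chart ?_ ?_ ?_
  · intro w
    obtain ⟨k, hk⟩ := H.exists_mem w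
    exact ⟨k, by rw [H.chart_source]; exact hk⟩
  · intro k l w hk hl
    rw [H.chart_source] at hk hl
    exact H.unique k l w hk hl
  · intro k V z hz
    have hV : (h k).symm ⁻¹' (V : Set Z) ∈ 𝓝 (h k z) :=
      (h k).symm.continuous.continuousAt.preimage_mem_nhds
        (by rw [(h k).symm_apply_apply]; exact V.isOpen.mem_nhds hz)
    obtain ⟨ε, hε, hball⟩ := Metric.mem_nhds_iff.1 hV
    have hmem : ∀ z', h k z' ∈ Metric.ball (h k z) ε ↔
        ∀ i, h k z i - ε < h k z' i ∧ h k z' i < h k z i + ε := by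
      intro z'
      rw [Metric.mem_ball, dist_pi_lt_iff hε]
      refine forall_congr' fun i => ?_
      rw [Real.dist_eq, abs_lt]
      constructor <;> rintro ⟨h1, h2⟩ <;> constructor <;> linarith
    -- Sup-norm balls are cubes, and cutting one with the open orthant raises the lower corner to
    -- `max 0 (h k z i - ε)`.
    refine ⟨⟨h k ⁻¹' Metric.ball (h k z) ε, Metric.isOpen_ball.preimage (h k).continuous⟩,
      Metric.mem_ball_self hε, fun i => max 0 (h k z i - ε), fun i => h k z i + ε,
      fun x hx => H.openOrthant_subset_chart_target k fun i =>
        (le_max_left _ _).trans_lt (hx i).1, fun w hw hwV => ⟨hw, fun i => ?_⟩, fun w hw => ?_⟩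
    · rw [H.chart_source] at hw
      have h1 := (hmem _).1 hwV i
      exact ⟨max_lt (hw i) h1.1, h1.2⟩
    · have h1 := hball ((hmem w.1).2 fun i =>
        ⟨(le_max_right _ _).trans_lt (hw.2 i).1, (hw.2 i).2⟩)
      rw [Set.mem_preimage, (h k).symm_apply_apply] at h1
      exact h1

end IsOrthantUnion

end Orthants

/-! ### Uniform matroids and the orthant charts of the tropical torus. -/

section Uniform

theorem uniformMatroid_indep_iff (r m : ℕ) (I : Set (Fin m)) :
    (uniformMatroid r m).Indep I ↔ I.ncard ≤ r := by
  simp [uniformMatroid]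

theorem not_isCircuit_uniformMatroid_self (m : ℕ) (C : Set (Fin m)) :
    ¬ (uniformMatroid m m).IsCircuit C := fun hC =>
  hC.not_indep ((uniformMatroid_indep_iff _ _ _).2 (by
    simpa using Set.ncard_le_ncard (Set.subset_univ C)))

theorem isCircuit_uniformMatroid_iff (n : ℕ) (C : Set (Fin (n + 1))) :
    (uniformMatroid n (n + 1)).IsCircuit C ↔ C = Set.univ := by
  have huniv : ∀ C : Set (Fin (n + 1)), ¬ (uniformMatroid n (n + 1)).Indep C ↔ C = Set.univ := by
    intro C
    rw [uniformMatroid_indep_iff, not_le]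
    constructor
    · intro h
      exact Set.eq_of_subset_of_ncard_le (Set.subset_univ C) (by simpa using h)
    · rintro rfl
      simp
  constructor
  · exact fun hC => (huniv C).1 hC.not_indep
  · rintro rfl
    rw [Matroid.isCircuit_iff]
    refine ⟨⟨(huniv _).2 rfl, fun x _ => by simp [uniformMatroid]⟩, fun D hD _ => (huniv D).1 hD.not_indep⟩

variable {n : ℕ}

/-- The differences with the `k`-th coordinate. -/
def coordDiff (k : Fin (n + 1)) : (Fin (n + 1) → ℝ) →ₗ[ℝ] (Fin n → ℝ) :=
  LinearMap.pi fun j =>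
    (LinearMap.proj k : (Fin (n + 1) → ℝ) →ₗ[ℝ] ℝ) - LinearMap.proj (k.succAbove j)

theorem coordDiff_apply (k : Fin (n + 1)) (v : Fin (n + 1) → ℝ) (j : Fin n) :
    coordDiff k v j = v k - v (k.succAbove j) := rfl

theorem ker_coordDiff (k : Fin (n + 1)) :
    LinearMap.ker (coordDiff k) = Submodule.span ℝ {(1 : Fin (n + 1) → ℝ)} := by
  ext v
  rw [LinearMap.mem_ker, Submodule.mem_span_singleton]
  constructor
  · intro h
    refine ⟨v k, funext fun l => ?_⟩
    rcases Fin.eq_self_or_eq_succAbove k l with rfl | ⟨j, rfl⟩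
    · simp
    · have := congrFun h j
      rw [coordDiff_apply, Pi.zero_apply, sub_eq_zero] at this
      simpa using this
  · rintro ⟨c, rfl⟩
    ext j
    simp [coordDiff_apply]

theorem coordDiff_surjective (k : Fin (n + 1)) : Function.Surjective (coordDiff k) := fun x =>
  ⟨k.insertNth 0 (-x), by ext j; simp [coordDiff_apply]⟩

instance isClosed_span_one (E : Type) [Finite E] :
    IsClosed (Submodule.span ℝ {(1 : E → ℝ)} : Set (E → ℝ)) :=
  Submodule.closed_of_finiteDimensional _

/-- The coordinates on the tropical torus given by the differences with the `k`-th coordinate. -/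
noncomputable def torusEquiv (k : Fin (n + 1)) :
    TropicalTorus (Fin (n + 1)) ≃L[ℝ] (Fin n → ℝ) :=
  ((Submodule.quotEquivOfEq _ _ (ker_coordDiff k).symm).trans
    ((coordDiff k).quotKerEquivOfSurjective (coordDiff_surjective k))).toContinuousLinearEquiv

theorem torusEquiv_mkQ (k : Fin (n + 1)) (v : Fin (n + 1) → ℝ) (j : Fin n) :
    torusEquiv k ((Submodule.span ℝ {(1 : Fin (n + 1) → ℝ)}).mkQ v) j =
      v k - v (k.succAbove j) := rfl

theorem tropicalLinearSpace_uniformMatroid_self (n : ℕ) :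
    tropicalLinearSpace (uniformMatroid (n + 1) (n + 1)) = Set.univ := by
  refine Set.eq_univ_of_forall fun x => ?_
  obtain ⟨v, rfl⟩ := Submodule.mkQ_surjective _ x
  exact ⟨v, fun C hC => (not_isCircuit_uniformMatroid_self _ C hC).elim, rfl⟩

/-- Being in the `k`-th orthant means that `v k` exceeds every other coordinate, while on the only
circuit the maximum is repeated exactly when no coordinate does so. For `n = 0` the orthant is the
whole point, so the space is empty. -/
theorem mem_tropicalLinearSpace_uniformMatroid_iff (x : TropicalTorus (Fin (n + 1))) :
    x ∈ tropicalLinearSpace (uniformMatroid n (n + 1)) ↔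
      ¬ ∃ k, torusEquiv k x ∈ openOrthant n := by
  constructor
  · rintro ⟨v, hv, rfl⟩ ⟨k, hk⟩
    obtain ⟨i, -, j, -, hij, hi, hj⟩ := hv _ ((isCircuit_uniformMatroid_iff n _).2 rfl)
    have key : ∀ l, l ≠ k → ¬ ∀ m ∈ (Set.univ : Set (Fin (n + 1))), v m ≤ v l := by
      intro l hl hmax
      obtain ⟨j', rfl⟩ := Fin.exists_succAbove_eq hl
      have h1 := hk j'
      rw [torusEquiv_mkQ] at h1
      linarith [hmax k trivial]
    by_cases hik : i = k
    · exact key j (fun h => hij (hik.trans h.symm)) hj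
    · exact key i hik hi
  · intro h
    obtain ⟨v, rfl⟩ := Submodule.mkQ_surjective _ x
    obtain ⟨i, hi⟩ := Finite.exists_max v
    have h1 : ∃ j, ¬ 0 < v i - v (i.succAbove j) := not_forall.1 fun h2 => h ⟨i, h2⟩
    obtain ⟨j, hj⟩ := h1
    refine ⟨v, fun C hC => ?_, rfl⟩
    obtain rfl := (isCircuit_uniformMatroid_iff n C).1 hC
    exact ⟨i, trivial, i.succAbove j, trivial, (Fin.succAbove_ne i j).symm, fun l _ => hi l,
      fun l _ => (hi l).trans (by linarith)⟩

/-- The charts of `X`. -/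
noncomputable def chartX (n : ℕ) (k : Fin (n + 1)) : X n ≃ₜ (Fin n → ℝ) :=
  ((Homeomorph.setCongr (tropicalLinearSpace_uniformMatroid_self n)).trans
    (Homeomorph.Set.univ _)).trans (torusEquiv k).toHomeomorph

theorem chartX_apply (n : ℕ) (k : Fin (n + 1)) (x : X n) : chartX n k x = torusEquiv k x.1 := rfl

theorem isOrthantUnion_compl_D (n : ℕ) : IsOrthantUnion (D n)ᶜ (chartX n) where
  mem_iff x := by
    rw [Set.mem_compl_iff, D, Set.mem_ofPred_eq, mem_tropicalLinearSpace_uniformMatroid_iff,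
      not_not]
    rfl
  unique k l x hk hl := by
    rw [chartX_apply] at hk hl
    obtain ⟨v, hv⟩ := Submodule.mkQ_surjective _ x.1
    rw [← hv] at hk hl
    by_contra hkl
    obtain ⟨i, hi⟩ := Fin.exists_succAbove_eq (Ne.symm hkl)
    obtain ⟨j, hj⟩ := Fin.exists_succAbove_eq hkl
    have h1 := hk i
    have h2 := hl j
    rw [torusEquiv_mkQ, hi] at h1
    rw [torusEquiv_mkQ, hj] at h2
    linarith

/-- Differences of integers are integers, and conversely the representative with `k`-th coordinate
`0` has integer entries. -/
theorem torusEquiv_mkQ_integral_iff (k : Fin (n + 1)) (w : Fin (n + 1) → ℝ) :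
    (∃ z : Fin (n + 1) → ℤ, (Submodule.span ℝ {(1 : Fin (n + 1) → ℝ)}).mkQ w =
      (Submodule.span ℝ {(1 : Fin (n + 1) → ℝ)}).mkQ (fun k => (z k : ℝ))) ↔
    ∃ z : Fin n → ℤ, torusEquiv k ((Submodule.span ℝ {(1 : Fin (n + 1) → ℝ)}).mkQ w) =
      fun k => (z k : ℝ) := by
  constructor
  · rintro ⟨z, hz⟩
    refine ⟨fun j => z k - z (k.succAbove j), ?_⟩
    rw [hz]
    ext j
    rw [torusEquiv_mkQ]
    push_cast
    rfl
  · rintro ⟨z, hz⟩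
    refine ⟨k.insertNth 0 (-z), (torusEquiv k).injective ?_⟩
    rw [hz]
    ext j
    rw [torusEquiv_mkQ]
    simp

end Uniform

end TropicalComplement

theorem mainTheorem11 (n : ℕ) :
    -- `X ≃ ℝ^n`, compatibly with the integral affine structures
    (∃ e : TropicalComplement.TropicalTorus (Fin (n + 1)) ≃L[ℝ] (Fin n → ℝ),
      e '' TropicalComplement.tropicalLinearSpace
          (TropicalComplement.uniformMatroid (n + 1) (n + 1)) = Set.univ ∧
      ∀ w : Fin (n + 1) → ℝ,
        (∃ z : Fin (n + 1) → ℤ, (Submodule.span ℝ {(1 : Fin (n + 1) → ℝ)}).mkQ w =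
          (Submodule.span ℝ {(1 : Fin (n + 1) → ℝ)}).mkQ (fun k => (z k : ℝ))) ↔
        ∃ z : Fin n → ℤ,
          e ((Submodule.span ℝ {(1 : Fin (n + 1) → ℝ)}).mkQ w) = fun k => (z k : ℝ)) ∧
    ∃ i : TopCat.of ↥(TropicalComplement.D n)ᶜ ⟶
        TopCat.of (TropicalComplement.Dagger (TropicalComplement.D n)ᶜ),
      (∀ x, i x = TropicalComplement.toDagger (TropicalComplement.D n)ᶜ x) ∧
      IsOpenEmbedding i ∧
      TropicalComplement.LocallyAspheric i ∧
      ∃ h : i ≫ TropicalComplement.daggerMap (TropicalComplement.D n)ᶜ =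
          TropicalComplement.inclusionMap (TropicalComplement.D n)ᶜ,
        IsIso (TropicalComplement.comparison i
          (TropicalComplement.daggerMap (TropicalComplement.D n)ᶜ)
          (TropicalComplement.inclusionMap (TropicalComplement.D n)ᶜ) h) := by
  have H := TropicalComplement.isOrthantUnion_compl_D n
  refine ⟨⟨TropicalComplement.torusEquiv 0, ?_,
    TropicalComplement.torusEquiv_mkQ_integral_iff 0⟩,
    TopCat.ofHom ⟨_, H.continuous_toDagger⟩, fun _ => rfl, H.isOpenEmbedding_toDagger,
    H.locallyAspheric_toDagger, rfl, H.isIso_comparison _ (fun _ => rfl) rfl⟩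
  rw [TropicalComplement.tropicalLinearSpace_uniformMatroid_self, Set.image_univ]
  exact (TropicalComplement.torusEquiv 0).surjective.range_eq
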